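/- A 3-graph is a pair $H=(V,E)$ with $V$ a finite set of vertices and $E\subseteq\binom V3$ a set of 3-element subsets of $V$ (edges). Let $P_3^3$ be the linear path of length 3, i.e. the 3-graph on 7 vertices $a,b,c,d,e,f,g$ with edges $\{a,b,c\},\{c,d,e\},\{e,f,g\}$, and let $C_3^3$ be the triangle, i.e. the 3-graph on 6 vertices $a,b,c,d,e,f$ with edges $\{a,b,c\},\{c,d,e\},\{e,f,a\}$. Let $ex_3(n;P_3^3|C_3^3)$ be the maximum number of edges in a 3-graph on $n$ vertices that contains no copy of $P_3^3$ (as a not necessarily induced subhypergraph) but contains a copy of $C_3^3$, and let $Ex_3(n;P_3^3|C_3^3)$ be the set of all such 3-graphs on $n$ vertices with exactly $ex_3(n;P_3^3|C_3^3)$ edges, taken up to isomorphism. Let $K_6^3$ be the complete 3-graph on 6 vertices, let $S_m^3$ be the full star on $m$ vertices, whose edges are all the $\binom{m-1}{2}$ triples containing one fixed vertex, and let $\cup$ denote the union of vertex-disjoint copies. Then for every $n\ge 14$, $$ex_3(n;P_3^3|C_3^3)=20+\binom{n-7}{2}\quad\text{and}\quad Ex_3(n;P_3^3|C_3^3)=\{K_6^3\cup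 S_{n-6}^3\}.$$ -/

import Mathlib

/-- A `k`-uniform hypergraph (`k`-graph) on the vertex set `V`: a finite family of `k`-element
subsets of `V`. -/
@[ext]
structure KGraph (k : ℕ) (V : Type*) where
  edges : Finset (Finset V)
  card_of_mem : ∀ e ∈ edges, e.card = k

namespace KGraph

/-- `F.ContainedIn H`: the `k`-graph `H` contains a copy of `F` as a (not necessarily induced)
subhypergraph. -/
def ContainedIn {k : ℕ} {V W : Type*} (F : KGraph k V) (H : KGraph k W) : Prop :=
  ∃ f : V ↪ W, ∀ e ∈ F.edges, e.map f ∈ H.edges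

/-- `H` is `F`-free: it contains no copy of `F`. -/
def Free {k : ℕ} {V W : Type*} (F : KGraph k V) (H : KGraph k W) : Prop :=
  ¬ F.ContainedIn H

/-- Isomorphism of `k`-graphs: a bijection of the vertex sets that carries edges to edges and
non-edges to non-edges. -/
def Isomorphic {k : ℕ} {V W : Type*} (G : KGraph k V) (H : KGraph k W) : Prop :=
  ∃ f : V ≃ W, ∀ e : Finset V, e ∈ G.edges ↔ e.map f.toEmbedding ∈ H.edges

/-- The linear path `P_3^3`: three edges, consecutive ones sharing exactly one vertex, the first
and the third disjoint (hence on seven vertices). -/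
def linearPath33 : KGraph 3 (Fin 7) where
  edges := {{0, 1, 2}, {2, 3, 4}, {4, 5, 6}}
  card_of_mem := by simp

/-- The triangle `C_3^3`: vertices `a, b, c, d, e, f` (here `0, …, 5`) and edges
`{a, b, c}`, `{c, d, e}`, `{e, f, a}`. -/
def triangle33 : KGraph 3 (Fin 6) where
  edges := {{0, 1, 2}, {2, 3, 4}, {4, 5, 0}}
  card_of_mem := by simp

/-- The complete `k`-graph `K_n^k`. -/
def complete (k n : ℕ) : KGraph k (Fin n) where
  edges := Finset.univ.powersetCard k
  card_of_mem _ he := (Finset.mem_powersetCard.mp he).2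

/-- The full star `S_n^k` with centre the vertex `0` of `Fin n`: its edges are all `k`-subsets
containing the centre. -/
def fullStar (k n : ℕ) : KGraph k (Fin n) where
  edges := (Finset.univ.powersetCard k).filter fun e => ∃ v ∈ e, (v : ℕ) = 0
  card_of_mem _ he := (Finset.mem_powersetCard.mp (Finset.mem_filter.mp he).1).2

/-- The union of vertex-disjoint copies of `G` and `H`. -/
def disjointUnion {k : ℕ} {V W : Type*} [DecidableEq V] [DecidableEq W]
    (G : KGraph k V) (H : KGraph k W) : KGraph k (V ⊕ W) where
  edges := G.edges.image (fun e => e.map Function.Embedding.inl) ∪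
    H.edges.image (fun e => e.map Function.Embedding.inr)
  card_of_mem e he := by
    rcases Finset.mem_union.mp he with he | he
    · obtain ⟨a, ha, rfl⟩ := Finset.mem_image.mp he
      rw [Finset.card_map]
      exact G.card_of_mem a ha
    · obtain ⟨a, ha, rfl⟩ := Finset.mem_image.mp he
      rw [Finset.card_map]
      exact H.card_of_mem a ha

/-- The edge counts of the `F`-free `k`-graphs on `n` vertices that contain a copy of `G`. -/
def condEdgeCounts {k : ℕ} {V W : Type*} (n : ℕ) (F : KGraph k V) (G : KGraph k W) : Set ℕ :=
  {m | ∃ H : KGraph k (Fin n), F.Free H ∧ G.ContainedIn H ∧ H.edges.card = m}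

/-- The conditional Turán number `ex_k(n; F | G)`: the largest number of edges in an `n`-vertex
`F`-free `k`-graph that contains a copy of `G`. (The set is finite, see `bddAbove_condEdgeCounts`,
so this is a maximum as soon as such a `k`-graph exists.) -/
noncomputable def condTuran {k : ℕ} {V W : Type*} (n : ℕ) (F : KGraph k V) (G : KGraph k W) : ℕ :=
  sSup (condEdgeCounts n F G)

theorem bddAbove_condEdgeCounts {k : ℕ} {V W : Type*} (n : ℕ) (F : KGraph k V)
    (G : KGraph k W) : BddAbove (condEdgeCounts n F G) := by
  refine ⟨(Finset.univ : Finset (Finset (Fin n))).card, ?_⟩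
  rintro m ⟨H, -, -, rfl⟩
  exact Finset.card_le_card (Finset.subset_univ _)

/-- `H` is extremal for `ex_k(n; F | G)`, where `n` is its number of vertices. -/
def IsCondExtremal {k : ℕ} {V W U : Type*} [Fintype U] (F : KGraph k V) (G : KGraph k W)
    (H : KGraph k U) : Prop :=
  F.Free H ∧ G.ContainedIn H ∧ H.edges.card = condTuran (Fintype.card U) F G

end KGraph

/-! Let U be the vertex set of a triangle in a path-free family on n vertices. An edge that meets U
without lying in it can meet U only in one of six pairs, the two-element sets that hit all three
triangle edges (`trace_mem`). If there is no such edge, U splits off: at most 20 edges lie in U, and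
the others form a path-free family on n - 6 vertices. If there are such edges and S is the set of
their outer vertices, then at most 14 triples survive in U, at most 3 max(|S|, 2) edges are attached
to it, and all remaining edges avoid both U and S (`exists_component`). This second case loses
strictly (`component_bound_lt`).

What remains is the Turán number of the path: for m ≥ 8 it is C(m-1, 2), attained only by the full
star (`card_le_of_pathFree`). The hypothesis n ≥ 14 is what puts m = n - 6 in this range. The proof
is by strong induction; a triangle is treated as above, and `card_le_of_pathFree_triangleFree`
covers families that also have no triangle.

For the latter, take a vertex v of maximum degree. If that degree is small, double counting
suffices. Otherwise the link of v contains two disjoint pairs, and an edge avoiding v must contain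
one of them or miss both (`Link.matching`). Hence the family is a star, or has a vertex of low
degree to delete, or splits into a star at v and a family on the vertices outside the link
(`structure_of_pathFree_triangleFree`). -/

namespace KGraph

open Finset

/-! ### Forbidden configurations expressed by intersection sizes -/

/-- A family of triples without a linear path of length three. -/
def PathFree {V : Type*} [DecidableEq V] (F : Finset (Finset V)) : Prop :=
  ∀ e ∈ F, ∀ f ∈ F, ∀ g ∈ F, (e ∩ f).card = 1 → (f ∩ g).card = 1 → (e ∩ g).card ≠ 0

/-- A family of triples without a triangle. -/
def TriangleFree {V : Type*} [DecidableEq V] (F : Finset (Finset V)) : Prop :=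
  ∀ e ∈ F, ∀ f ∈ F, ∀ g ∈ F, (e ∩ f).card = 1 → (f ∩ g).card = 1 → (e ∩ g).card = 1 →
    (e ∩ f ∩ g).Nonempty

theorem PathFree.mono {V : Type*} [DecidableEq V] {F G : Finset (Finset V)} (h : PathFree F)
    (hG : G ⊆ F) : PathFree G :=
  fun e he f hf g hg => h e (hG he) f (hG hf) g (hG hg)

theorem TriangleFree.mono {V : Type*} [DecidableEq V] {F G : Finset (Finset V)}
    (h : TriangleFree F) (hG : G ⊆ F) : TriangleFree G :=
  fun e he f hf g hg => h e (hG he) f (hG hf) g (hG hg)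

theorem exists_eq_triple_of_mem {V : Type*} [DecidableEq V] {e : Finset V} (he : e.card = 3)
    {x : V} (hx : x ∈ e) : ∃ a b, a ≠ b ∧ a ≠ x ∧ b ≠ x ∧ e = {x, a, b} := by
  have h2 : (e.erase x).card = 2 := by rw [card_erase_of_mem hx, he]
  obtain ⟨a, b, hab, h⟩ := card_eq_two.mp h2
  have ha : a ∈ e.erase x := by simp [h]
  have hb : b ∈ e.erase x := by simp [h]
  exact ⟨a, b, hab, ne_of_mem_erase ha, ne_of_mem_erase hb, by rw [← h, insert_erase hx]⟩

theorem exists_eq_triple_of_mem_of_mem {V : Type*} [DecidableEq V] {e : Finset V}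
    (he : e.card = 3) {x y : V} (hx : x ∈ e) (hy : y ∈ e) (hxy : x ≠ y) :
    ∃ a, a ≠ x ∧ a ≠ y ∧ e = {x, y, a} := by
  obtain ⟨a, b, hab, ha, hb, rfl⟩ := exists_eq_triple_of_mem he hx
  simp only [mem_insert, mem_singleton] at hy
  rcases hy with rfl | rfl | rfl
  · exact absurd rfl hxy
  · exact ⟨b, hb, hab.symm, rfl⟩
  · exact ⟨a, ha, hab, by rw [pair_comm]⟩

theorem pathFree_of_free {V : Type*} [DecidableEq V] {H : KGraph 3 V}
    (h : linearPath33.Free H) : PathFree H.edges := by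
  intro e he f hf g hg hef hfg heg
  apply h
  obtain ⟨x, hx⟩ := card_eq_one.mp hef
  obtain ⟨y, hy⟩ := card_eq_one.mp hfg
  have heg' : ∀ z, z ∈ e → z ∉ g := fun z h1 h2 => by
    have : z ∈ e ∩ g := mem_inter.mpr ⟨h1, h2⟩
    simp [card_eq_zero.mp heg] at this
  have hx' : ∀ z, z ∈ e ∧ z ∈ f ↔ z = x := fun z => by rw [← mem_inter, hx, mem_singleton]
  have hy' : ∀ z, z ∈ f ∧ z ∈ g ↔ z = y := fun z => by rw [← mem_inter, hy, mem_singleton]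
  obtain ⟨hxe, hxf⟩ := (hx' x).2 rfl
  obtain ⟨hyf, hyg⟩ := (hy' y).2 rfl
  have hxy : x ≠ y := fun h => heg' x hxe (h ▸ hyg)
  obtain ⟨a, b, hab, hax, hbx, rfl⟩ := exists_eq_triple_of_mem (H.card_of_mem e he) hxe
  obtain ⟨d, hdx, hdy, rfl⟩ := exists_eq_triple_of_mem_of_mem (H.card_of_mem f hf) hxf hyf hxy
  obtain ⟨p, q, hpq, hpy, hqy, rfl⟩ := exists_eq_triple_of_mem (H.card_of_mem g hg) hyg
  have ha1 := hx' a
  have hb1 := hx' b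
  have hp1 := hy' p
  have hq1 := hy' q
  have ha2 := heg' a
  have hb2 := heg' b
  have hx2 := heg' x
  simp only [mem_insert, mem_singleton] at ha1 hb1 hp1 hq1 ha2 hb2 hx2
  have hinj : Function.Injective ![a, b, x, d, y, p, q] := by
    rw [← List.nodup_ofFn]
    simp [List.ofFn_succ]
    grind
  refine ⟨⟨_, hinj⟩, ?_⟩
  intro s hs
  simp only [linearPath33, mem_insert, mem_singleton] at hs
  rcases hs with rfl | rfl | rfl
  · convert he using 1; ext z; simp; grind
  · convert hf using 1; ext z; simp; grind
  · convert hg using 1; ext z; simp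

theorem free_of_pathFree {V : Type*} [DecidableEq V] {H : KGraph 3 V}
    (h : PathFree H.edges) : linearPath33.Free H := by
  rintro ⟨φ, hφ⟩
  refine h _ (hφ {0, 1, 2} (by decide)) _ (hφ {2, 3, 4} (by decide)) _
    (hφ {4, 5, 6} (by decide)) ?_ ?_ ?_ <;>
  · rw [← map_inter, card_map]; decide

theorem exists_embedding_of_not_triangleFree {V : Type*} [DecidableEq V]
    {F : Finset (Finset V)} (h3 : ∀ e ∈ F, e.card = 3) (h : ¬ TriangleFree F) :
    ∃ φ : Fin 6 ↪ V, ∀ e ∈ triangle33.edges, e.map φ ∈ F := by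
  simp only [TriangleFree, not_forall, not_nonempty_iff_eq_empty] at h
  obtain ⟨e, he, f, hf, g, hg, hef, hfg, heg, hn⟩ := h
  obtain ⟨x, hx⟩ := card_eq_one.mp hef
  obtain ⟨y, hy⟩ := card_eq_one.mp hfg
  obtain ⟨w, hw⟩ := card_eq_one.mp heg
  have hn' : ∀ z, z ∈ e → z ∈ f → z ∉ g := fun z h1 h2 h3 => by
    have : z ∈ e ∩ f ∩ g := mem_inter.mpr ⟨mem_inter.mpr ⟨h1, h2⟩, h3⟩
    rw [hn] at this
    simp at this
  have hx' : ∀ z, z ∈ e ∧ z ∈ f ↔ z = x := fun z => by rw [← mem_inter, hx, mem_singleton]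
  have hy' : ∀ z, z ∈ f ∧ z ∈ g ↔ z = y := fun z => by rw [← mem_inter, hy, mem_singleton]
  have hw' : ∀ z, z ∈ e ∧ z ∈ g ↔ z = w := fun z => by rw [← mem_inter, hw, mem_singleton]
  obtain ⟨hxe, hxf⟩ := (hx' x).2 rfl
  obtain ⟨hyf, hyg⟩ := (hy' y).2 rfl
  obtain ⟨hwe, hwg⟩ := (hw' w).2 rfl
  have hxy : x ≠ y := fun h => hn' x hxe hxf (h ▸ hyg)
  have hxw : x ≠ w := fun h => hn' x hxe hxf (h ▸ hwg)
  have hyw : y ≠ w := fun h => hn' y (h ▸ hwe) hyf hyg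
  obtain ⟨a, hax, haw, rfl⟩ := exists_eq_triple_of_mem_of_mem (h3 e he) hxe hwe hxw
  obtain ⟨b, hbx, hby, rfl⟩ := exists_eq_triple_of_mem_of_mem (h3 f hf) hxf hyf hxy
  obtain ⟨c, hcy, hcw, rfl⟩ := exists_eq_triple_of_mem_of_mem (h3 g hg) hyg hwg hyw
  have ha1 := hx' a
  have ha2 := hw' a
  have hb1 := hx' b
  have hb2 := hy' b
  have hc1 := hy' c
  have hc2 := hw' c
  simp only [mem_insert, mem_singleton] at ha1 hb1 ha2 hb2 hc1 hc2
  have hinj : Function.Injective ![w, a, x, b, y, c] := by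
    rw [← List.nodup_ofFn]
    simp [List.ofFn_succ]
    grind
  refine ⟨⟨_, hinj⟩, ?_⟩
  intro s hs
  simp only [triangle33, mem_insert, mem_singleton] at hs
  rcases hs with rfl | rfl | rfl
  · convert he using 1; ext z; simp; grind
  · convert hf using 1; ext z; simp; grind
  · convert hg using 1; ext z; simp; grind

/-! ### Links of a vertex of large degree -/

/-- `Link F v a b`: the pair `{a, b}` belongs to the link of `v` in `F`. -/
def Link {V : Type*} [DecidableEq V] (F : Finset (Finset V)) (v a b : V) : Prop :=
  a ≠ b ∧ a ≠ v ∧ b ≠ v ∧ ({v, a, b} : Finset V) ∈ F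

section Link

variable {V : Type*} [DecidableEq V] {F : Finset (Finset V)} {X : Finset V} {v : V}

theorem Link.symm {a b : V} (h : Link F v a b) : Link F v b a :=
  ⟨h.1.symm, h.2.2.1, h.2.1, by rw [pair_comm]; exact h.2.2.2⟩

theorem exists_link_of_mem (h3 : ∀ e ∈ F, e.card = 3) {e : Finset V} (he : e ∈ F) (hv : v ∈ e) :
    ∃ a b, Link F v a b ∧ e = {v, a, b} := by
  obtain ⟨a, b, hab, hav, hbv, rfl⟩ := exists_eq_triple_of_mem (h3 e he) hv
  exact ⟨a, b, ⟨hab, hav, hbv, he⟩, rfl⟩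

theorem degree_le_of_link (h3 : ∀ e ∈ F, e.card = 3) (T : Finset (Finset V))
    (hT : ∀ a b, Link F v a b → ({v, a, b} : Finset V) ∈ T) :
    (F.filter (v ∈ ·)).card ≤ T.card := by
  apply card_le_card
  intro e he
  obtain ⟨he, hv⟩ := mem_filter.mp he
  obtain ⟨a, b, h, rfl⟩ := exists_link_of_mem h3 he hv
  exact hT a b h

/-- The two edges through `v` meet only in `v`. If `g` hits one pair exactly once, then missing the
other pair gives a path, and hitting it exactly once gives a triangle. -/
theorem Link.matching (hP : PathFree F) (hT : TriangleFree F)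
    {a b c d : V} (hab : Link F v a b) (hcd : Link F v c d)
    (hac : a ≠ c) (had : a ≠ d) (hbc : b ≠ c) (hbd : b ≠ d) {g : Finset V} (hg : g ∈ F)
    (hv : v ∉ g) :
    (a ∈ g ∧ b ∈ g) ∨ (c ∈ g ∧ d ∈ g) ∨ (a ∉ g ∧ b ∉ g ∧ c ∉ g ∧ d ∉ g) := by
  obtain ⟨h1, h2, h3, he⟩ := hab
  obtain ⟨h4, h5, h6, hf⟩ := hcd
  have hef : ({v, a, b} ∩ {v, c, d} : Finset V) = {v} := by ext z; simp; grind
  have hfe : ({v, c, d} ∩ {v, a, b} : Finset V) = {v} := by rw [inter_comm]; exact hef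
  have c1 : (({v, a, b} : Finset V) ∩ g).card =
      (if a ∈ g then 1 else 0) + (if b ∈ g then 1 else 0) := by
    rw [insert_inter_of_notMem hv]
    by_cases ha : a ∈ g <;> by_cases hb : b ∈ g <;> simp [ha, hb, h1]
  have c2 : (({v, c, d} : Finset V) ∩ g).card =
      (if c ∈ g then 1 else 0) + (if d ∈ g then 1 else 0) := by
    rw [insert_inter_of_notMem hv]
    by_cases ha : c ∈ g <;> by_cases hb : d ∈ g <;> simp [ha, hb, h4]
  have p1 := hP _ he _ hf _ hg (by rw [hef, card_singleton])
  have p2 := hP _ hf _ he _ hg (by rw [hfe, card_singleton])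
  have p3 := hT _ he _ hf _ hg (by rw [hef, card_singleton])
  rw [hef, singleton_inter_of_notMem hv] at p3
  rw [c1, c2] at p1 p2 p3
  simp only [Finset.not_nonempty_empty] at p3
  by_cases ha : a ∈ g <;> by_cases hb : b ∈ g <;> by_cases hc : c ∈ g <;> by_cases hd : d ∈ g <;>
    simp_all

theorem card_triple_le_three (a b c : Finset V) : ({a, b, c} : Finset (Finset V)).card ≤ 3 :=
  card_le_three

/-- A link with at least seven pairs which is not a star contains two disjoint pairs. -/
theorem exists_disjoint_links (h3 : F ⊆ X.powersetCard 3) (hvX : v ∈ X)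
    (h7 : 7 ≤ (F.filter (v ∈ ·)).card) (hk : X.card ≤ (F.filter (v ∈ ·)).card + 1) :
    ∃ a b c d, Link F v a b ∧ Link F v c d ∧ a ≠ c ∧ a ≠ d ∧ b ≠ c ∧ b ≠ d := by
  have hX : ∀ e ∈ F, e ⊆ X := fun e he => (mem_powersetCard.mp (h3 he)).1
  have hc : ∀ e ∈ F, e.card = 3 := fun e he => (mem_powersetCard.mp (h3 he)).2
  -- No vertex covers the link: a star in it has at most `X.card - 2` pairs.
  have key : ∀ z, z ≠ v → ∃ p q, Link F v p q ∧ p ≠ z ∧ q ≠ z := by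
    intro z hz
    by_contra! hcon
    by_cases hzX : z ∈ X
    · have := degree_le_of_link (v := v) hc (((X.erase v).erase z).image fun y => {v, z, y}) (by
        intro p q h
        rw [mem_image]
        have hs := hX _ h.2.2.2
        by_cases hp : p = z
        · subst hp
          exact ⟨q, by simp [h.1.symm, h.2.2.1, hs (show q ∈ {v, p, q} by simp)], rfl⟩
        · have hq := hcon p q h hp
          subst hq
          exact ⟨p, by simp [h.1, h.2.1, hs (show p ∈ {v, p, q} by simp)], by rw [pair_comm]⟩)
      have h2 := card_image_le (s := (X.erase v).erase z) (f := fun y => ({v, z, y} : Finset V))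
      rw [card_erase_of_mem (by simp [hz, hzX]), card_erase_of_mem hvX] at h2
      omega
    · have := degree_le_of_link (v := v) hc ∅ (by
        intro p q h
        have hs := hX _ h.2.2.2
        by_cases hp : p = z
        · exact absurd (hs (show p ∈ {v, p, q} by simp)) (hp ▸ hzX)
        · exact absurd (hs (show q ∈ {v, p, q} by simp)) (hcon p q h hp ▸ hzX))
      rw [card_empty] at this
      omega
  -- Pairwise intersecting pairs without a common vertex form a triangle `a`, `b`, `c`, which would
  -- make the degree at most 3.
  by_contra! hcon
  have hne : (F.filter (v ∈ ·)).Nonempty := card_pos.mp (by omega)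
  obtain ⟨e, he⟩ := hne
  obtain ⟨he, hv⟩ := mem_filter.mp he
  obtain ⟨a, b, hab, -⟩ := exists_link_of_mem hc he hv
  have hb : ∃ c, c ≠ a ∧ c ≠ b ∧ Link F v b c := by
    obtain ⟨p, q, h, h1, h2⟩ := key a hab.2.1
    have := hcon a b p q hab h
    have h' := h.symm
    have := h.1
    grind +splitImp
  obtain ⟨c, hca, hcb, hbc⟩ := hb
  have ha : Link F v a c := by
    obtain ⟨p, q, h, h1, h2⟩ := key b hab.2.2.1
    have := hcon a b p q hab h
    have := hcon b c p q hbc h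
    have h' := h.symm
    have := h.1
    grind +splitImp
  have := degree_le_of_link (v := v) hc {{v, a, b}, {v, b, c}, {v, a, c}} (by
    intro p q h
    have h1 := hcon _ _ _ _ hab h
    have h2 := hcon _ _ _ _ hbc h
    have h3 := hcon _ _ _ _ ha h
    have := h.1
    have := hab.1
    have := hbc.1
    have := ha.1
    have : (p = a ∧ q = b ∨ p = b ∧ q = a) ∨ (p = b ∧ q = c ∨ p = c ∧ q = b) ∨
      (p = a ∧ q = c ∨ p = c ∧ q = a) := by grind +splitImp
    rcases this with (⟨rfl, rfl⟩ | ⟨rfl, rfl⟩) | (⟨rfl, rfl⟩ | ⟨rfl, rfl⟩) | ⟨rfl, rfl⟩ | ⟨rfl, rfl⟩ <;>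
    simp [pair_comm])
  have h5 := card_triple_le_three ({v, a, b} : Finset V) {v, b, c} {v, a, c}
  omega

/-- If every edge avoiding `v` is closed under the link of `v`, then a vertex of such an edge
which lies on the link has small degree. -/
theorem degree_le_of_no_crossing (h3 : F ⊆ X.powersetCard 3) (hvX : v ∈ X)
    (hM : ∃ a b c d, Link F v a b ∧ Link F v c d ∧ a ≠ c ∧ a ≠ d ∧ b ≠ c ∧ b ≠ d)
    (hN : ∀ g ∈ F, v ∉ g → ∀ u ∈ g, ∀ w, Link F v u w → w ∈ g)
    {g : Finset V} (hg : g ∈ F) (hv : v ∉ g) {a b : V} (hab : Link F v a b) (ha : a ∈ g) :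
    (F.filter (a ∈ ·)).card ≤ max 3 (X.card - 4) := by
  have hX : ∀ e ∈ F, e ⊆ X := fun e he => (mem_powersetCard.mp (h3 he)).1
  have hc : ∀ e ∈ F, e.card = 3 := fun e he => (mem_powersetCard.mp (h3 he)).2
  have hb := hN g hg hv a ha b hab
  obtain ⟨x, hxa, hxb, rfl⟩ := exists_eq_triple_of_mem_of_mem (hc g hg) ha hb hab.1
  have hNa : ∀ w, Link F v a w → w = b ∨ w = x := fun w hw => by
    have := hN _ hg hv a (by simp) w hw
    have := hw.1
    simp at this
    grind
  have hNb : ∀ w, Link F v b w → w = a ∨ w = x := fun w hw => by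
    have := hN _ hg hv b (by simp) w hw
    have := hw.1
    simp at this
    grind
  -- An edge at `a` that avoids `v` must contain the link neighbour `b` as well.
  have hform : ∀ p q, Link F a p q → (∃ t, Link F v a t ∧ ({a, p, q} : Finset V) = {v, a, t}) ∨
      ∃ t, t ≠ v ∧ t ≠ a ∧ t ≠ b ∧ ({a, p, q} : Finset V) = {a, b, t} ∧
        ({a, b, t} : Finset V) ∈ F := by
    intro p q h
    by_cases hve : v ∈ ({a, p, q} : Finset V)
    · left
      obtain ⟨t, h1, h2, h4⟩ := exists_eq_triple_of_mem_of_mem (hc _ h.2.2.2) hve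
        (show a ∈ ({a, p, q} : Finset V) by simp) hab.2.1.symm
      exact ⟨t, ⟨h2.symm, hab.2.1, h1, h4 ▸ h.2.2.2⟩, h4⟩
    · right
      have hbe := hN _ h.2.2.2 hve a (by simp) b hab
      obtain ⟨t, h1, h2, h4⟩ := exists_eq_triple_of_mem_of_mem (hc _ h.2.2.2)
        (show a ∈ ({a, p, q} : Finset V) by simp) hbe hab.1
      refine ⟨t, ?_, h1, h2, h4, h4 ▸ h.2.2.2⟩
      rintro rfl
      exact hve (h4 ▸ by simp)
  -- A link neighbour of `x` lies in `g`, so it is `a` or `b`; closure then forces `x` into every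
  -- edge through `a` that avoids `v`, and three candidates remain.
  by_cases hx : ∃ y, Link F v x y
  · obtain ⟨y, hy⟩ := hx
    have hyg := hN _ hg hv x (by simp) y hy
    refine le_trans ?_ (le_max_left _ _)
    refine le_trans (degree_le_of_link hc {{v, a, b}, {v, a, x}, {a, b, x}} ?_)
      (card_triple_le_three _ _ _)
    intro p q h
    rcases hform p q h with ⟨t, ht, h4⟩ | ⟨t, h0, h1, h2, h4, h5⟩
    · rw [h4]
      rcases hNa t ht with rfl | rfl <;> simp
    · have hvt : v ∉ ({a, b, t} : Finset V) := by
        simp [hab.2.1.symm, hab.2.2.1.symm, h0.symm]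
      have : x ∈ ({a, b, t} : Finset V) := by
        refine hN _ h5 hvt y ?_ x hy.symm
        have := hy.1
        simp at hyg
        simp
        grind
      have : t = x := by
        simp at this
        grind
      rw [h4, this]
      simp
  · obtain ⟨c, d, hcd, hca, hda⟩ : ∃ c d, Link F v c d ∧ c ≠ a ∧ d ≠ a := by
      obtain ⟨c, d, c', d', h1, h2, h4, h5, h6, h7⟩ := hM
      by_cases h : c ≠ a ∧ d ≠ a
      · exact ⟨c, d, h1, h⟩
      · exact ⟨c', d', h2, by grind, by grind⟩
    have hx' : ∀ y, ¬ Link F v x y := fun y hy => hx ⟨y, hy⟩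
    have hcb : c ≠ b := by
      rintro rfl
      rcases hNb d hcd with rfl | rfl
      · exact hda rfl
      · exact hx' _ hcd.symm
    have hdb : d ≠ b := by
      rintro rfl
      rcases hNb c hcd.symm with rfl | rfl
      · exact hca rfl
      · exact hx' _ hcd
    refine le_trans ?_ (le_max_right _ _)
    -- Apart from `{v, a, b}`, the edges at `a` are `{a, b, y}`. Here `y` is neither `c` nor `d`,
    -- since closure would bring in the other one too; this leaves `X.card - 5` values of `y`.
    have key := degree_le_of_link (v := a) hc
      (insert {v, a, b} ((X \ {v, a, b, c, d}).image fun y => {a, b, y})) (by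
      intro p q h
      rw [mem_insert, mem_image]
      rcases hform p q h with ⟨t, ht, h4⟩ | ⟨t, h0, h1, h2, h4, h5⟩
      · left
        rw [h4]
        rcases hNa t ht with rfl | rfl
        · rfl
        · exact absurd ht.symm (hx' _)
      · right
        have hvt : v ∉ ({a, b, t} : Finset V) := by
          simp [hab.2.1.symm, hab.2.2.1.symm, h0.symm]
        refine ⟨t, ?_, h4.symm⟩
        have hcd1 := hcd.1
        have htc : t ≠ c := by
          rintro rfl
          have := hN _ h5 hvt t (by simp) d hcd
          simp at this
          grind
        have htd : t ≠ d := by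
          rintro rfl
          have := hN _ h5 hvt t (by simp) c hcd.symm
          simp at this
          grind
        simp [h0, h1, h2, htc, htd]
        exact hX _ h5 (by simp))
    have h5 : ({v, a, b, c, d} : Finset V).card = 5 := by
      have := hab.1; have := hab.2.1; have := hab.2.2.1
      have := hcd.1; have := hcd.2.1; have := hcd.2.2.1
      rw [card_insert_of_notMem, card_insert_of_notMem, card_insert_of_notMem,
        card_insert_of_notMem, card_singleton] <;> simp <;> grind
    have hsub : ({v, a, b, c, d} : Finset V) ⊆ X := by
      have s1 := hX _ hab.2.2.2
      have s2 := hX _ hcd.2.2.2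
      simp [insert_subset_iff] at s1 s2 ⊢
      grind
    have h6 := card_image_le (s := X \ {v, a, b, c, d}) (f := fun y => ({a, b, y} : Finset V))
    have h7 := card_insert_le ({v, a, b} : Finset V)
      ((X \ {v, a, b, c, d}).image fun y => ({a, b, y} : Finset V))
    rw [card_sdiff_of_subset hsub, h5] at h6
    have := card_le_card hsub
    omega

/-- If some link pair of `v` crosses an edge that avoids `v`, then there is a vertex of degree at
most three. -/
theorem exists_degree_le_three_of_crossing (hP : PathFree F) (hT : TriangleFree F)
    (h3 : F ⊆ X.powersetCard 3) (h7 : 7 ≤ (F.filter (v ∈ ·)).card)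
    (hM : ∃ a b c d, Link F v a b ∧ Link F v c d ∧ a ≠ c ∧ a ≠ d ∧ b ≠ c ∧ b ≠ d)
    {g : Finset V} (hg : g ∈ F) (hv : v ∉ g) {u w : V} (huw : Link F v u w) (hu : u ∈ g)
    (hw : w ∉ g) : ∃ a ∈ X, (F.filter (a ∈ ·)).card ≤ 3 := by
  classical
  have hX : ∀ e ∈ F, e ⊆ X := fun e he => (mem_powersetCard.mp (h3 he)).1
  have hc : ∀ e ∈ F, e.card = 3 := fun e he => (mem_powersetCard.mp (h3 he)).2
  -- every link pair lies in `g` or meets a given crossing pair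
  have cross : ∀ u ∈ g, ∀ w, w ∉ g → Link F v u w → ∀ p q, Link F v p q →
      (p ∈ g ∧ q ∈ g) ∨ p = u ∨ p = w ∨ q = u ∨ q = w := by
    intro u hu w hw huw p q hpq
    have := Link.matching hP hT huw hpq
    grind
  obtain ⟨g1, g2, g3, h12, h13, h23, hgeq⟩ := card_eq_three.mp (hc g hg)
  have hin : ∀ p q, Link F v p q → p ∈ g → q ∈ g →
      ({v, p, q} : Finset V) ∈ ({{v, g1, g2}, {v, g1, g3}, {v, g2, g3}} : Finset (Finset V)) := by
    intro p q h hp hq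
    have := h.1
    simp only [hgeq, mem_insert, mem_singleton] at hp hq
    rcases hp with rfl | rfl | rfl <;> rcases hq with rfl | rfl | rfl <;>
      simp [pair_comm] at this ⊢
  -- the link is a star apart from the pairs inside `g`
  obtain ⟨z, hz⟩ : ∃ z, ∀ p q, Link F v p q → (p ∈ g ∧ q ∈ g) ∨ p = z ∨ q = z := by
    -- If neither `u` nor `w` serves as centre, the pairs not inside `g` form a triangle `u`, `w`,
    -- `t`. With the at most three pairs inside `g` this gives degree at most 6.
    by_contra! hcon
    obtain ⟨p, q, hpq, h1, h2, h4⟩ := hcon u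
    obtain ⟨p', q', hpq', h1', h2', h4'⟩ := hcon w
    obtain ⟨t, ht, hwt, htu⟩ : ∃ t, t ≠ w ∧ Link F v w t ∧ t ≠ u := by
      have hne := hpq.1
      rcases cross u hu w hw huw p q hpq with h | rfl | rfl | rfl | rfl
      · exact absurd h.2 (h1 h.1)
      · exact absurd rfl h2
      · exact ⟨q, hne.symm, hpq, h4⟩
      · exact absurd rfl h4
      · exact ⟨p, hne, hpq.symm, h2⟩
    obtain ⟨w', hw', hw'g, huw'⟩ : ∃ w', w' ≠ w ∧ w' ∉ g ∧ Link F v u w' := by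
      rcases cross u hu w hw huw p' q' hpq' with h | rfl | rfl | rfl | rfl
      · exact absurd h.2 (h1' h.1)
      · exact ⟨q', h4', h1' hu, hpq'⟩
      · exact absurd rfl h2'
      · exact ⟨p', h2', fun h => h1' h hu, hpq'.symm⟩
      · exact absurd rfl h4'
    have htw' : t = w' := by
      have := cross u hu w' hw'g huw' w t hwt
      grind
    subst htw'
    have := degree_le_of_link (v := v) hc
      ({{v, g1, g2}, {v, g1, g3}, {v, g2, g3}} ∪ {{v, u, w}, {v, u, t}, {v, w, t}}) (by
      intro p q h
      rw [mem_union]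
      by_cases hpqg : p ∈ g ∧ q ∈ g
      · exact Or.inl (hin p q h hpqg.1 hpqg.2)
      · right
        have hout : ∀ p q, Link F v p q → ¬ (p ∈ g ∧ q ∈ g) → p = u ∨ q = u ∨
            (p = w ∧ q = t) ∨ (p = t ∧ q = w) := by
          intro p q h hpqg
          have := cross u hu w hw huw p q h
          have := cross u hu t hw'g huw' p q h
          grind
        have hu' : ∀ q, Link F v u q → q ∉ g → q = w ∨ q = t := by
          intro q h hq
          have := cross u hu q hq h w t hwt
          grind
        rcases hout p q h hpqg with rfl | rfl | ⟨rfl, rfl⟩ | ⟨rfl, rfl⟩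
        · rcases hu' q h (fun h => hpqg ⟨hu, h⟩) with rfl | rfl <;> simp
        · rcases hu' p h.symm (fun h => hpqg ⟨h, hu⟩) with rfl | rfl <;> simp [pair_comm]
        · simp
        · simp [pair_comm])
    have h5 := card_union_le ({{v, g1, g2}, {v, g1, g3}, {v, g2, g3}} : Finset (Finset V))
      {{v, u, w}, {v, u, t}, {v, w, t}}
    have h6 := card_triple_le_three ({v, g1, g2} : Finset V) {v, g1, g3} {v, g2, g3}
    have h8 := card_triple_le_three ({v, u, w} : Finset V) {v, u, t} {v, w, t}
    omega
  obtain ⟨a, b, hab, haz, hbz⟩ : ∃ a b, Link F v a b ∧ a ≠ z ∧ b ≠ z := by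
    obtain ⟨c, d, c', d', h1, h2, h4, h5, h6, h7⟩ := hM
    by_cases h : c ≠ z ∧ d ≠ z
    · exact ⟨c, d, h1, h⟩
    · exact ⟨c', d', h2, by grind, by grind⟩
  obtain ⟨hag, hbg⟩ : a ∈ g ∧ b ∈ g := by
    have := hz a b hab
    grind
  -- the leaves of the star
  set L := X.filter (fun y => Link F v z y) with hL
  have hL4 : 4 ≤ L.card := by
    have := degree_le_of_link (v := v) hc
      ({{v, g1, g2}, {v, g1, g3}, {v, g2, g3}} ∪ L.image fun y => {v, z, y}) (by
      intro p q h
      rw [mem_union, mem_image]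
      rcases hz p q h with h1 | rfl | rfl
      · exact Or.inl (hin p q h h1.1 h1.2)
      · exact Or.inr ⟨q, mem_filter.mpr ⟨hX _ h.2.2.2 (by simp), h⟩, rfl⟩
      · exact Or.inr ⟨p, mem_filter.mpr ⟨hX _ h.2.2.2 (by simp), h.symm⟩, by rw [pair_comm]⟩)
    have h5 := card_union_le ({{v, g1, g2}, {v, g1, g3}, {v, g2, g3}} : Finset (Finset V))
      (L.image fun y => {v, z, y})
    have h6 := card_triple_le_three ({v, g1, g2} : Finset V) {v, g1, g3} {v, g2, g3}
    have h8 := card_image_le (s := L) (f := fun y => ({v, z, y} : Finset V))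
    omega
  obtain ⟨y, hyL, hyg⟩ : ∃ y ∈ L, y ∉ g := by
    by_contra! hcon
    have := card_le_card (show L ⊆ g from hcon)
    rw [hc g hg] at this
    omega
  obtain ⟨t, htL, hta⟩ : ∃ t ∈ L, t ∉ ({a, b, y} : Finset V) := by
    by_contra! hcon
    have := card_le_card (show L ⊆ {a, b, y} from hcon)
    have := card_le_three (a := a) (b := b) (c := y)
    omega
  obtain ⟨hyX, hy⟩ := mem_filter.mp hyL
  obtain ⟨-, ht⟩ := mem_filter.mp htL
  simp only [mem_insert, mem_singleton, not_or] at hta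
  -- A leaf `y` outside `g` has low degree. Comparing an edge at `y` that avoids `v` with the pairs
  -- `zy`, `ab` forces it to contain `a, b` or `z`; in the second case the pairs `zt`, `ab` fix the
  -- third vertex.
  refine ⟨y, hyX, le_trans (degree_le_of_link hc {{v, z, y}, {a, b, y}, {z, y, t}} ?_)
    (card_triple_le_three _ _ _)⟩
  intro p q h
  set e : Finset V := {y, p, q} with he
  have heF : e ∈ F := h.2.2.2
  have hye : y ∈ e := by simp [he]
  have hya : y ≠ a := fun h => hyg (h ▸ hag)
  have hyb : y ≠ b := fun h => hyg (h ▸ hbg)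
  have eq3 : ∀ r s, r ∈ e → s ∈ e → r ≠ s → r ≠ y → s ≠ y → e = {r, s, y} := by
    intro r s hr hs h1 h2 h4
    symm
    apply eq_of_subset_of_card_le
    · simp [insert_subset_iff, hr, hs, hye]
    · rw [hc e heF, card_eq_three.mpr ⟨r, s, y, h1, h2, h4, rfl⟩]
  by_cases hve : v ∈ e
  · obtain ⟨r, hr1, hr2, hr⟩ := exists_eq_triple_of_mem_of_mem (hc _ heF) hve hye hy.2.2.1.symm
    have hl : Link F v y r := ⟨hr2.symm, hy.2.2.1, hr1, hr ▸ heF⟩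
    have : r = z := by
      have := hz y r hl
      have := hy.1
      grind
    rw [hr, this, pair_comm y z]
    simp
  · have m1 := Link.matching hP hT hy hab haz.symm hbz.symm hya hyb heF hve
    rcases m1 with ⟨hze, -⟩ | ⟨hae, hbe⟩ | ⟨-, hye', -⟩
    · have m2 := Link.matching hP hT ht hab haz.symm hbz.symm hta.1 hta.2.1 heF hve
      rcases m2 with ⟨-, hte⟩ | ⟨hae, hbe⟩ | ⟨hze', -⟩
      · rw [eq3 z t hze hte ht.1 hy.1 hta.2.2, pair_comm t y]
        simp
      · rw [eq3 a b hae hbe hab.1 hya.symm hyb.symm]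
        simp
      · exact absurd hze hze'
    · rw [eq3 a b hae hbe hab.1 hya.symm hyb.symm]
      simp
    · exact absurd hye hye'

end Link

/-! ### Counting without paths and triangles -/

section Bound

variable {V : Type*} [DecidableEq V]

theorem card_eq_degree_add (F : Finset (Finset V)) (a : V) :
    F.card = (F.filter (a ∈ ·)).card + (F.filter (a ∉ ·)).card :=
  (card_filter_add_card_filter_not (s := F) (fun e => a ∈ e)).symm

theorem choose_two_add (m r : ℕ) : (m + r).choose 2 = m.choose 2 + r.choose 2 + m * r := by
  induction r with
  | zero => simp
  | succ r ih =>
    rw [← add_assoc, Nat.choose_succ_succ' (m + r) 1, Nat.choose_succ_succ' r 1, ih]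
    simp
    ring

/-- The number of triples of `X` through a fixed vertex. -/
theorem card_star {X : Finset V} {v : V} (hv : v ∈ X) :
    ((X.powersetCard 3).filter (v ∈ ·)).card = (X.card - 1).choose 2 := by
  have h := card_eq_degree_add (X.powersetCard 3) v
  have h2 : (X.powersetCard 3).filter (v ∉ ·) = (X.erase v).powersetCard 3 := by
    ext e
    simp only [mem_filter, mem_powersetCard, subset_erase]
    tauto
  rw [h2, card_powersetCard, card_powersetCard, card_erase_of_mem hv] at h
  obtain ⟨k, hk⟩ : ∃ k, X.card = k + 1 := ⟨X.card - 1, by have := card_pos.mpr ⟨v, hv⟩; omega⟩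
  rw [hk, Nat.choose_succ_succ' k 2] at h
  rw [hk]
  simp at h ⊢
  omega

theorem filter_notMem_subset {F : Finset (Finset V)} {X : Finset V} (h3 : F ⊆ X.powersetCard 3)
    (a : V) : F.filter (a ∉ ·) ⊆ (X.erase a).powersetCard 3 := by
  intro e he
  obtain ⟨he, ha⟩ := mem_filter.mp he
  obtain ⟨h1, h2⟩ := mem_powersetCard.mp (h3 he)
  exact mem_powersetCard.mpr ⟨subset_erase.mpr ⟨h1, ha⟩, h2⟩

theorem card_le_choose_three {W : Type*} {F : Finset (Finset W)} {X : Finset W}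
    (h3 : F ⊆ X.powersetCard 3) : F.card ≤ X.card.choose 3 := by
  simpa using card_le_card h3

/-- A rough description of the families without linear path and triangle. -/
theorem structure_of_pathFree_triangleFree {F : Finset (Finset V)} {X : Finset V}
    (hP : PathFree F) (hT : TriangleFree F) (h3 : F ⊆ X.powersetCard 3) (hne : X.Nonempty) :
    (∃ v ∈ X, ∀ e ∈ F, v ∈ e) ∨
    (∃ a ∈ X, (F.filter (a ∈ ·)).card ≤ max 3 (X.card - 4)) ∨
    3 * F.card ≤ X.card * max (X.card - 2) 6 ∨
    ∃ v ∈ X, ∃ R ⊆ X, v ∉ R ∧ 3 ≤ R.card ∧ R.card + 5 ≤ X.card ∧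
      ∀ e ∈ F, e ⊆ R ∨ (v ∈ e ∧ e ⊆ X \ R) := by
  classical
  have hX : ∀ e ∈ F, e ⊆ X := fun e he => (mem_powersetCard.mp (h3 he)).1
  have hc : ∀ e ∈ F, e.card = 3 := fun e he => (mem_powersetCard.mp (h3 he)).2
  obtain ⟨v, hvX, hmax⟩ := exists_max_image X (fun v => (F.filter (v ∈ ·)).card) hne
  by_cases hd : (F.filter (v ∈ ·)).card ≤ max (X.card - 2) 6
  · right; right; left
    -- Double counting of incidences: the degrees sum to `3 * F.card`.
    have h1 := sum_card_inter_le (s := X) (B := F) (n := max (X.card - 2) 6)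
      (fun a ha => (hmax a ha).trans hd)
    have h2 : ∑ t ∈ F, (X ∩ t).card = ∑ t ∈ F, 3 :=
      sum_congr rfl fun t ht => by rw [inter_eq_right.mpr (hX t ht), hc t ht]
    rw [h2, sum_const, smul_eq_mul] at h1
    omega
  have hM := exists_disjoint_links h3 hvX (by omega) (by omega)
  by_cases hstar : ∀ e ∈ F, v ∈ e
  · exact Or.inl ⟨v, hvX, hstar⟩
  push Not at hstar
  obtain ⟨g, hg, hvg⟩ := hstar
  by_cases hN : ∀ g ∈ F, v ∉ g → ∀ u ∈ g, ∀ w, Link F v u w → w ∈ g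
  swap
  · push Not at hN
    obtain ⟨g, hg, hvg, u, hu, w, huw, hw⟩ := hN
    obtain ⟨a, ha, h⟩ := exists_degree_le_three_of_crossing hP hT h3 (by omega) hM hg hvg huw hu hw
    exact Or.inr (Or.inl ⟨a, ha, h.trans (le_max_left _ _)⟩)
  by_cases hU : ∃ g ∈ F, v ∉ g ∧ ∃ u ∈ g, ∃ w, Link F v u w
  · obtain ⟨g, hg, hvg, u, hu, w, huw⟩ := hU
    exact Or.inr (Or.inl ⟨u, hX g hg hu, degree_le_of_no_crossing h3 hvX hM hN hg hvg huw hu⟩)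
  push Not at hU
  right; right; right
  -- Edges avoiding `v` now contain no vertex of the link, so `R` contains them all, while edges
  -- through `v` avoid `R`.
  set R := X.filter (fun x => x ≠ v ∧ ∀ y, ¬ Link F v x y) with hR
  have hsub : ∀ e ∈ F, v ∉ e → e ⊆ R := fun e he hve x hx =>
    mem_filter.mpr ⟨hX e he hx, fun h => hve (h ▸ hx), hU e he hve x hx⟩
  refine ⟨v, hvX, R, filter_subset _ _, by simp [hR], ?_, ?_, ?_⟩
  · rw [← hc g hg]
    exact card_le_card (hsub g hg hvg)
  · obtain ⟨a, b, c, d, hab, hcd, h1, h2, h4, h5⟩ := hM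
    have h6 : ({v, a, b, c, d} : Finset V).card = 5 := by
      have := hab.1; have := hab.2.1; have := hab.2.2.1
      have := hcd.1; have := hcd.2.1; have := hcd.2.2.1
      rw [card_insert_of_notMem, card_insert_of_notMem, card_insert_of_notMem,
        card_insert_of_notMem, card_singleton] <;> simp <;> grind
    have h7 : ({v, a, b, c, d} : Finset V) ⊆ X \ R := by
      have s1 := hX _ hab.2.2.2
      have s2 := hX _ hcd.2.2.2
      simp only [insert_subset_iff, singleton_subset_iff] at s1 s2
      simp only [insert_subset_iff, singleton_subset_iff, mem_sdiff, hR, mem_filter]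
      exact ⟨⟨hvX, fun h => h.2.1 rfl⟩, ⟨s1.2.1, fun h => h.2.2 _ hab⟩,
        ⟨s1.2.2, fun h => h.2.2 _ hab.symm⟩, ⟨s2.2.1, fun h => h.2.2 _ hcd⟩,
        ⟨s2.2.2, fun h => h.2.2 _ hcd.symm⟩⟩
    have h8 := card_le_card h7
    have hRX : R ⊆ X := filter_subset _ _
    rw [card_sdiff_of_subset hRX, h6] at h8
    omega
  · intro e he
    by_cases hve : v ∈ e
    · refine Or.inr ⟨hve, fun x hx => mem_sdiff.mpr ⟨hX e he hx, fun hxR => ?_⟩⟩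
      obtain ⟨-, hxv, hl⟩ := mem_filter.mp hxR
      obtain ⟨r, hr1, hr2, hr⟩ := exists_eq_triple_of_mem_of_mem (hc e he) hve hx hxv.symm
      exact hl r ⟨hr2.symm, hxv, hr1, hr ▸ he⟩
    · exact Or.inl (hsub e he hve)

theorem choose_three_le_choose_two {n : ℕ} (hn : n ≤ 5) : n.choose 3 ≤ n.choose 2 := by
  interval_cases n <;> decide

/-- The maximum number of edges without linear path and triangle. -/
theorem card_le_of_pathFree_triangleFree (n : ℕ) : ∀ (F : Finset (Finset V)) (X : Finset V),
    PathFree F → TriangleFree F → F ⊆ X.powersetCard 3 → X.card = n →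
    (n = 6 → F.card ≤ 13) ∧ (n = 7 → F.card ≤ 16) ∧
    (8 ≤ n → F.card ≤ (n - 1).choose 2 ∧
      (F.card = (n - 1).choose 2 → ∃ v ∈ X, F = (X.powersetCard 3).filter (v ∈ ·))) := by
  induction n using Nat.strong_induction_on with
  | _ n ih =>
  intro F X hP hT h3 hn
  by_cases hn6 : n < 6
  · exact ⟨fun h => by omega, fun h => by omega, fun h => by omega⟩
  have hX : ∀ e ∈ F, e ⊆ X := fun e he => (mem_powersetCard.mp (h3 he)).1
  have hc : ∀ e ∈ F, e.card = 3 := fun e he => (mem_powersetCard.mp (h3 he)).2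
  rcases structure_of_pathFree_triangleFree hP hT h3 (card_pos.mp (by omega)) with
    ⟨v, hvX, hv⟩ | ⟨a, haX, ha⟩ | h | ⟨v, hvX, R, hRX, hvR, hR3, hR5, hF⟩
  · have hsub : F ⊆ (X.powersetCard 3).filter (v ∈ ·) := fun e he =>
      mem_filter.mpr ⟨h3 he, hv e he⟩
    have h1 := card_le_card hsub
    rw [card_star hvX, hn] at h1
    refine ⟨?_, ?_, fun _ => ⟨h1, fun h => ⟨v, hvX, eq_of_subset_of_card_le hsub ?_⟩⟩⟩
    · rintro rfl
      exact h1.trans (by decide)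
    · rintro rfl
      exact h1.trans (by decide)
    · rw [card_star hvX, hn, h]
  -- Deleting `a` produces the small bounds: 3 + 10 = 13 for n = 6 and 3 + 13 = 16 for n = 7. These
  -- suffice to start, as 4 + 16 < 21 for n = 8; beyond that, the loss n - 4 is below the increment
  -- n - 2.
  · have h1 := card_eq_degree_add F a
    have hsub := filter_notMem_subset h3 a
    have hcard : (X.erase a).card = n - 1 := by rw [card_erase_of_mem haX, hn]
    have h2 := ih (n - 1) (by omega) (F.filter (a ∉ ·)) (X.erase a)
      (hP.mono (filter_subset _ _)) (hT.mono (filter_subset _ _)) hsub hcard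
    rw [hn] at ha
    refine ⟨?_, ?_, ?_⟩
    · rintro rfl
      have h4 := card_le_choose_three hsub
      rw [hcard] at h4
      have : Nat.choose (6 - 1) 3 = 10 := by decide
      omega
    · rintro rfl
      have := h2.1 rfl
      omega
    · intro h8
      suffices F.card < (n - 1).choose 2 from ⟨this.le, fun h => absurd h this.ne⟩
      rcases h8.eq_or_lt with rfl | h9
      · have := h2.2.1 rfl
        have : Nat.choose (8 - 1) 2 = 21 := by decide
        omega
      · have := (h2.2.2 (by omega)).1
        obtain ⟨m, rfl⟩ : ∃ m, n = m + 2 := ⟨n - 2, by omega⟩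
        have h5 := Nat.choose_succ_succ' m 1
        simp at h5 this ha ⊢
        omega
  · rw [hn] at h
    refine ⟨?_, ?_, ?_⟩
    · rintro rfl
      simp at h
      omega
    · rintro rfl
      simp at h
      omega
    · intro h8
      suffices F.card < (n - 1).choose 2 from ⟨this.le, fun h => absurd h this.ne⟩
      obtain ⟨m, rfl⟩ : ∃ m, n = m + 2 := ⟨n - 2, by omega⟩
      rw [max_eq_left (by omega)] at h
      have h5 := Nat.triangle_succ m
      rw [Nat.choose_two_right]
      simp at h h5 ⊢
      have h6 : 2 * ((m + 1) * m / 2) = (m + 1) * m :=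
        Nat.mul_div_cancel' (by rw [mul_comm]; exact (Nat.even_mul_succ_self m).two_dvd)
      nlinarith
  · have hlt : 8 ≤ n := by omega
    refine ⟨by omega, by omega, fun _ => ?_⟩
    suffices F.card < (n - 1).choose 2 from ⟨this.le, fun h => absurd h this.ne⟩
    have h1 := card_eq_degree_add F v
    have h2 : (F.filter (v ∈ ·)).card ≤ (n - R.card - 1).choose 2 := by
      have hvS : v ∈ X \ R := mem_sdiff.mpr ⟨hvX, hvR⟩
      rw [← hn, ← card_sdiff_of_subset hRX, ← card_star hvS]
      apply card_le_card
      intro e he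
      obtain ⟨he, hve⟩ := mem_filter.mp he
      rcases hF e he with h | h
      · exact absurd (h hve) hvR
      · exact mem_filter.mpr ⟨mem_powersetCard.mpr ⟨h.2, hc e he⟩, hve⟩
    have hsub : F.filter (v ∉ ·) ⊆ R.powersetCard 3 := by
      intro e he
      obtain ⟨he, hve⟩ := mem_filter.mp he
      rcases hF e he with h | h
      · exact mem_powersetCard.mpr ⟨h, hc e he⟩
      · exact absurd h.1 hve
    have h4 : (F.filter (v ∉ ·)).card ≤ R.card.choose 2 := by
      have h5 := ih R.card (by omega) _ R (hP.mono (filter_subset (v ∉ ·) _))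
        (hT.mono (filter_subset _ _)) hsub rfl
      by_cases hr : R.card ≤ 5
      · exact (card_le_choose_three hsub).trans (choose_three_le_choose_two hr)
      by_cases hr6 : R.card = 6
      · have := h5.1 hr6
        have : Nat.choose 6 2 = 15 := by decide
        rw [hr6]
        omega
      by_cases hr7 : R.card = 7
      · have := h5.2.1 hr7
        have : Nat.choose 7 2 = 21 := by decide
        rw [hr7]
        omega
      · exact (h5.2.2 (by omega)).1.trans (Nat.choose_le_choose 2 (by omega))
    -- The cross term `m * R.card` in `choose_two_add` makes the split strictly worse than one star.
    obtain ⟨m, hm⟩ : ∃ m, n - R.card - 1 = m := ⟨_, rfl⟩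
    have h5 : n - 1 = m + R.card := by omega
    rw [h5, choose_two_add]
    rw [hm] at h2
    have : 0 < m * R.card := Nat.mul_pos (by omega) (by omega)
    omega

end Bound

/-! ### Traces of edges on a triangle -/

section Trace

variable {V : Type*} [DecidableEq V]

/-- The trace of a set of vertices on an embedded six-element set. -/
def trace (φ : Fin 6 ↪ V) (e : Finset V) : Finset (Fin 6) := univ.filter (φ · ∈ e)

theorem mem_trace {φ : Fin 6 ↪ V} {e : Finset V} {i : Fin 6} : i ∈ trace φ e ↔ φ i ∈ e := by
  simp [trace]

theorem map_trace (φ : Fin 6 ↪ V) (e : Finset V) :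
    (trace φ e).map φ = e ∩ univ.map φ := by
  ext x
  simp only [mem_map, mem_trace, mem_inter, mem_univ, true_and]
  constructor
  · rintro ⟨i, hi, rfl⟩
    exact ⟨hi, i, rfl⟩
  · rintro ⟨hx, i, rfl⟩
    exact ⟨i, hx, rfl⟩

theorem card_trace_add (φ : Fin 6 ↪ V) (e : Finset V) :
    (trace φ e).card + (e \ univ.map φ).card = e.card := by
  rw [← card_map φ, map_trace, add_comm, card_sdiff_add_card_inter]

theorem trace_map (φ : Fin 6 ↪ V) (A : Finset (Fin 6)) : trace φ (A.map φ) = A := by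
  ext i
  simp [mem_trace]

theorem trace_inter (φ : Fin 6 ↪ V) (e f : Finset V) :
    trace φ (e ∩ f) = trace φ e ∩ trace φ f := by
  ext i
  simp [mem_trace]

theorem card_inter_map (φ : Fin 6 ↪ V) (e : Finset V) (A : Finset (Fin 6)) :
    (e ∩ A.map φ).card = (trace φ e ∩ A).card := by
  have h := card_trace_add φ (e ∩ A.map φ)
  rw [trace_inter, trace_map] at h
  have : (e ∩ A.map φ) \ univ.map φ = ∅ := by
    rw [sdiff_eq_empty_iff_subset]
    exact inter_subset_right.trans (map_subset_map.mpr (subset_univ _))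
  rw [this, card_empty] at h
  omega

theorem card_inter_eq_trace (φ : Fin 6 ↪ V) (e f : Finset V) :
    (e ∩ f).card = (trace φ e ∩ trace φ f).card +
      ((e \ univ.map φ) ∩ (f \ univ.map φ)).card := by
  rw [← card_trace_add φ (e ∩ f), trace_inter]
  congr 2
  ext x
  simp only [mem_inter, mem_sdiff]
  tauto

theorem eq_of_trace_eq {φ : Fin 6 ↪ V} {e f : Finset V} (h : trace φ e = trace φ f)
    (h' : e \ univ.map φ = f \ univ.map φ) : e = f := by
  rw [← sdiff_union_inter e (univ.map φ), ← sdiff_union_inter f (univ.map φ), ← map_trace,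
    ← map_trace, h, h']

/-- The six excluded pairs, two corners or a midpoint with the opposite corner, are exactly those
hitting all three triangle edges. Any other trace of size 1 or 2 misses some edge, where a path can
end. -/
theorem exists_path_of_trace (A : Finset (Fin 6)) : A.card = 1 ∨ (A.card = 2 ∧
    A ∉ ({{0, 2}, {1, 4}, {2, 4}, {0, 3}, {0, 4}, {2, 5}} : Finset (Finset (Fin 6)))) →
    ∃ f ∈ triangle33.edges, ∃ g ∈ triangle33.edges,
      (A ∩ f).card = 1 ∧ (f ∩ g).card = 1 ∧ (A ∩ g).card = 0 := by
  revert A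
  decide

theorem exists_edge_inter_pair (A : Finset (Fin 6)) : A.card = 2 →
    ∃ f ∈ triangle33.edges, (A ∩ f).card = 1 := by
  revert A
  decide

theorem card_separated_triples (A : Finset (Fin 6)) : A.card = 2 →
    (((univ : Finset (Fin 6)).powersetCard 3).filter fun T => (T ∩ A).card = 1).card = 12 ∧
    (((univ : Finset (Fin 6)).powersetCard 3).filter fun T => ¬ (T ∩ A).card = 1).card = 8 := by
  revert A
  decide

variable {F : Finset (Finset V)} {X : Finset V} {φ : Fin 6 ↪ V}

theorem trace_mem (hP : PathFree F) (hφ : ∀ e ∈ triangle33.edges, e.map φ ∈ F) {e : Finset V}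
    (he : e ∈ F) : ¬ ((trace φ e).card = 1 ∨ ((trace φ e).card = 2 ∧
    trace φ e ∉ ({{0, 2}, {1, 4}, {2, 4}, {0, 3}, {0, 4}, {2, 5}} : Finset (Finset (Fin 6))))) := by
  intro h
  obtain ⟨f, hf, g, hg, h1, h2, h4⟩ := exists_path_of_trace _ h
  refine hP e he _ (hφ f hf) _ (hφ g hg) ?_ ?_ ?_
  · rwa [card_inter_map]
  · rwa [← map_inter, card_map]
  · rwa [card_inter_map]

/-- Edges with opposite traces have a common outer vertex. -/
theorem sdiff_eq_of_trace (hP : PathFree F) (h3 : ∀ e ∈ F, e.card = 3)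
    (hφ : ∀ e ∈ triangle33.edges, e.map φ ∈ F) {e e' : Finset V}
    (he : e ∈ F) (he' : e' ∈ F) (h2 : (trace φ e).card = 2) (h2' : (trace φ e').card = 2)
    (hd : (trace φ e ∩ trace φ e').card = 0)
    (h : ∃ f ∈ triangle33.edges, (trace φ e ∩ f).card = 1 ∧ (f ∩ trace φ e').card = 1) :
    e \ univ.map φ = e' \ univ.map φ := by
  by_contra hne
  obtain ⟨f, hf, h4, h5⟩ := h
  have c1 := card_trace_add φ e
  have c2 := card_trace_add φ e'
  rw [h3 e he, h2] at c1
  rw [h3 e' he', h2'] at c2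
  obtain ⟨x, hx⟩ := card_eq_one.mp (show (e \ univ.map φ).card = 1 by omega)
  obtain ⟨y, hy⟩ := card_eq_one.mp (show (e' \ univ.map φ).card = 1 by omega)
  refine hP e he _ (hφ f hf) e' he' ?_ ?_ ?_
  · rwa [card_inter_map]
  · rw [inter_comm, card_inter_map, inter_comm]
    exact h5
  · rw [card_inter_eq_trace φ, hd, hx, hy]
    rw [hx, hy] at hne
    have : x ≠ y := fun h => hne (by rw [h])
    simp [this]

/-- Of the 20 triples on the six vertices, 12 meet the trace of `e` in one vertex. They form 6
complementary pairs, and `T`, `e`, `Tᶜ` would be a path, so each pair contributes at most one edge: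
6 + 8 = 14. -/
theorem card_filter_subset_le (hP : PathFree F) (h3 : ∀ e ∈ F, e.card = 3) {e : Finset V}
    (he : e ∈ F) (h2 : (trace φ e).card = 2) :
    (F.filter fun f => (trace φ f).card = 3).card ≤ 14 := by
  set G := (F.filter fun f => (trace φ f).card = 3).image (trace φ) with hG
  have hmap : ∀ f ∈ F, (trace φ f).card = 3 → (trace φ f).map φ = f := by
    intro f hf hf3
    rw [map_trace]
    apply eq_of_subset_of_card_le inter_subset_left
    rw [← map_trace, card_map, hf3, h3 f hf]
  have hGF : ∀ T ∈ G, T.map φ ∈ F ∧ T.card = 3 := by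
    intro T hT
    obtain ⟨f, hf, rfl⟩ := mem_image.mp hT
    obtain ⟨hf, hf3⟩ := mem_filter.mp hf
    rw [hmap f hf hf3]
    exact ⟨hf, hf3⟩
  have hcard : G.card = (F.filter fun f => (trace φ f).card = 3).card := by
    apply card_image_of_injOn
    intro f hf g hg hfg
    obtain ⟨hf, hf3⟩ := mem_filter.mp hf
    obtain ⟨hg, hg3⟩ := mem_filter.mp hg
    rw [← hmap f hf hf3, ← hmap g hg hg3]
    exact congrArg _ hfg
  rw [← hcard]
  obtain ⟨h12, h8⟩ := card_separated_triples _ h2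
  set P := fun T : Finset (Fin 6) => (T ∩ trace φ e).card = 1 with hPdef
  have hsplit := card_filter_add_card_filter_not (s := G) P
  have hle : (G.filter fun T => ¬ P T).card ≤ 8 := by
    rw [← h8]
    apply card_le_card
    intro T hT
    obtain ⟨hT, hTP⟩ := mem_filter.mp hT
    exact mem_filter.mpr ⟨mem_powersetCard_univ.mpr (hGF T hT).2, hTP⟩
  have hcompl : ∀ T : Finset (Fin 6), P T → P Tᶜ := by
    intro T hT
    have h1 := card_sdiff_add_card_inter (trace φ e) T
    rw [sdiff_eq_inter_compl, h2] at h1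
    simp only [hPdef] at hT ⊢
    rw [inter_comm] at hT ⊢
    omega
  have hdisj : Disjoint (G.filter P) ((G.filter P).image compl) := by
    rw [disjoint_left]
    intro T hT hT'
    obtain ⟨T', hT₁, rfl⟩ := mem_image.mp hT'
    obtain ⟨h1, h4⟩ := mem_filter.mp hT
    obtain ⟨h1', h4'⟩ := mem_filter.mp hT₁
    refine hP _ (hGF _ h1).1 e he _ (hGF _ h1').1 ?_ ?_ ?_
    · rw [inter_comm, card_inter_map, inter_comm]
      exact h4
    · rw [card_inter_map, inter_comm]
      exact h4'
    · rw [← map_inter, card_map, inter_comm, inter_compl, card_empty]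
  have hle2 : (G.filter P ∪ (G.filter P).image compl).card ≤ 12 := by
    rw [← h12]
    apply card_le_card
    intro T hT
    rcases mem_union.mp hT with hT | hT
    · obtain ⟨hT, hTP⟩ := mem_filter.mp hT
      exact mem_filter.mpr ⟨mem_powersetCard_univ.mpr (hGF T hT).2, hTP⟩
    · obtain ⟨T', hT', rfl⟩ := mem_image.mp hT
      obtain ⟨hT, hTP⟩ := mem_filter.mp hT'
      refine mem_filter.mpr ⟨mem_powersetCard_univ.mpr ?_, hcompl _ hTP⟩
      rw [card_compl, (hGF _ hT).2]
      rfl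
  rw [card_union_of_disjoint hdisj, card_image_of_injective _ compl_injective] at hle2
  omega

/-- The number of edges with one of two opposite traces. -/
theorem card_opposite_traces_le (hP : PathFree F) (h3 : ∀ e ∈ F, e.card = 3)
    (hφ : ∀ e ∈ triangle33.edges, e.map φ ∈ F) {S : Finset V}
    (hS : ∀ e ∈ F, (trace φ e).card = 2 → e \ univ.map φ ⊆ S) (A B : Finset (Fin 6))
    (hA : A.card = 2) (hB : B.card = 2) (hAB : (A ∩ B).card = 0)
    (hf : ∃ f ∈ triangle33.edges, (A ∩ f).card = 1 ∧ (f ∩ B).card = 1) :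
    (F.filter fun e => trace φ e = A).card + (F.filter fun e => trace φ e = B).card ≤
      max S.card 2 := by
  have hle : ∀ A : Finset (Fin 6), A.card = 2 →
      (F.filter fun e => trace φ e = A).card ≤ S.card := by
    intro A hA
    have : S.card = (S.powersetCard 1).card := by
      rw [card_powersetCard, Nat.choose_one_right]
    rw [this]
    -- Among edges with a fixed trace, the outer vertex determines the edge.
    apply card_le_card_of_injOn (fun e => e \ univ.map φ)
    · intro e he
      obtain ⟨he, htr⟩ := mem_filter.mp he
      have c1 := card_trace_add φ e
      rw [h3 e he, htr, hA] at c1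
      exact mem_powersetCard.mpr ⟨hS e he (htr ▸ hA),
        show (e \ univ.map φ).card = 1 by omega⟩
    · intro e he e' he' hee'
      exact eq_of_trace_eq ((mem_filter.mp he).2.trans (mem_filter.mp he').2.symm) hee'
  by_cases hBe : F.filter (fun e => trace φ e = B) = ∅
  · rw [hBe, card_empty, add_zero]
    exact (hle A hA).trans (le_max_left _ _)
  by_cases hAe : F.filter (fun e => trace φ e = A) = ∅
  · rw [hAe, card_empty, zero_add]
    exact (hle B hB).trans (le_max_left _ _)
  obtain ⟨e, he⟩ := nonempty_iff_ne_empty.mpr hAe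
  obtain ⟨e', he'⟩ := nonempty_iff_ne_empty.mpr hBe
  -- When both classes are nonempty, all their edges share one outer vertex, so each class has a
  -- single edge; this is the 2 in the maximum.
  have key : ∀ e ∈ F.filter (fun e => trace φ e = A), ∀ e' ∈ F.filter (fun e => trace φ e = B),
      e \ univ.map φ = e' \ univ.map φ := by
    intro e he e' he'
    obtain ⟨h1, rfl⟩ := mem_filter.mp he
    obtain ⟨h2, rfl⟩ := mem_filter.mp he'
    exact sdiff_eq_of_trace hP h3 hφ h1 h2 hA hB hAB hf
  have h1 : (F.filter fun e => trace φ e = A).card ≤ 1 := card_le_one.mpr fun a ha b hb =>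
    eq_of_trace_eq ((mem_filter.mp ha).2.trans (mem_filter.mp hb).2.symm)
      ((key a ha e' he').trans (key b hb e' he').symm)
  have h2 : (F.filter fun e => trace φ e = B).card ≤ 1 := card_le_one.mpr fun a ha b hb =>
    eq_of_trace_eq ((mem_filter.mp ha).2.trans (mem_filter.mp hb).2.symm)
      ((key e he a ha).symm.trans (key e he b hb))
  omega

/-- The component of a triangle in a family without linear path. -/
theorem exists_component (hP : PathFree F) (h3 : F ⊆ X.powersetCard 3)
    (hφ : ∀ e ∈ triangle33.edges, e.map φ ∈ F) :
    ∃ U ⊆ X, U.card = 6 ∧ ((∀ e ∈ F, e ⊆ U ∨ e ⊆ X \ U) ∨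
      ∃ S ⊆ X \ U, S.Nonempty ∧ ∃ G ⊆ F, G ⊆ ((X \ U) \ S).powersetCard 3 ∧
        F.card ≤ 14 + 3 * max S.card 2 + G.card) := by
  have hX : ∀ e ∈ F, e ⊆ X := fun e he => (mem_powersetCard.mp (h3 he)).1
  have hc : ∀ e ∈ F, e.card = 3 := fun e he => (mem_powersetCard.mp (h3 he)).2
  have hUX : univ.map φ ⊆ X := by
    intro x hx
    obtain ⟨i, -, rfl⟩ := mem_map.mp hx
    have hi : ∀ i : Fin 6, ∃ e ∈ triangle33.edges, i ∈ e := by decide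
    obtain ⟨e, he, hie⟩ := hi i
    exact hX _ (hφ e he) (mem_map_of_mem φ hie)
  refine ⟨univ.map φ, hUX, by simp, ?_⟩
  have h0U : ∀ e ∈ F, (trace φ e).card = 0 → e ⊆ X \ univ.map φ := by
    intro e he h0 x hx
    refine mem_sdiff.mpr ⟨hX e he hx, fun hxU => ?_⟩
    obtain ⟨i, -, rfl⟩ := mem_map.mp hxU
    have := mem_trace.mpr hx
    rw [card_eq_zero.mp h0] at this
    simp at this
  have hcases : ∀ e ∈ F, (trace φ e).card = 0 ∨ (trace φ e).card = 2 ∨ (trace φ e).card = 3 := by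
    intro e he
    have c1 := card_trace_add φ e
    rw [hc e he] at c1
    have := trace_mem hP hφ he
    omega
  by_cases h2 : ∃ e ∈ F, (trace φ e).card = 2
  swap
  · left
    intro e he
    rcases hcases e he with h | h | h
    · exact Or.inr (h0U e he h)
    · exact absurd ⟨e, he, h⟩ h2
    · left
      have c1 := card_trace_add φ e
      rw [hc e he, h] at c1
      exact sdiff_eq_empty_iff_subset.mp (card_eq_zero.mp (by omega))
  right
  obtain ⟨e₀, he₀, h₀⟩ := h2
  set S := (F.filter fun e => (trace φ e).card = 2).biUnion (fun e => e \ univ.map φ) with hSdef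
  have hS : ∀ e ∈ F, (trace φ e).card = 2 → e \ univ.map φ ⊆ S := by
    intro e he h
    exact subset_biUnion_of_mem (fun e => e \ univ.map φ) (mem_filter.mpr ⟨he, h⟩)
  have hSX : S ⊆ X \ univ.map φ := by
    rw [hSdef, biUnion_subset]
    intro e he
    exact sdiff_subset_sdiff (hX e (mem_filter.mp he).1) (Subset.refl _)
  have hSne : S.Nonempty := by
    have c1 := card_trace_add φ e₀
    rw [hc e₀ he₀, h₀] at c1
    exact (card_pos.mp (show 0 < (e₀ \ univ.map φ).card by omega)).mono (hS e₀ he₀ h₀)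
  refine ⟨S, hSX, hSne, F.filter fun e => (trace φ e).card = 0, filter_subset _ _, ?_, ?_⟩
  · intro e he
    obtain ⟨he, h0⟩ := mem_filter.mp he
    refine mem_powersetCard.mpr ⟨fun x hx => mem_sdiff.mpr ⟨h0U e he h0 hx, fun hxS => ?_⟩,
      hc e he⟩
    -- An edge missing the triangle but containing an outer vertex would continue through `f` into a
    -- triangle edge, giving a path.
    obtain ⟨f, hf, hxf⟩ := mem_biUnion.mp hxS
    obtain ⟨hf, hf2⟩ := mem_filter.mp hf
    obtain ⟨g, hg, hfg⟩ := exists_edge_inter_pair _ hf2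
    have c1 := card_trace_add φ f
    rw [hc f hf, hf2] at c1
    refine hP e he f hf _ (hφ g hg) ?_ ?_ ?_
    · rw [card_inter_eq_trace φ, card_eq_zero.mp h0, empty_inter, card_empty, zero_add]
      apply le_antisymm
      · exact (card_le_card inter_subset_right).trans (by omega)
      · exact card_pos.mpr ⟨x, mem_inter.mpr
          ⟨mem_sdiff.mpr ⟨hx, (mem_sdiff.mp hxf).2⟩, hxf⟩⟩
    · rwa [card_inter_map]
    · rw [card_inter_map, card_eq_zero.mp h0, empty_inter, card_empty]
  · have k3 := card_filter_subset_le hP hc he₀ h₀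
    have k1 := card_opposite_traces_le hP hc hφ hS {0, 2} {1, 4} (by decide) (by decide)
      (by decide) (by decide)
    have k2 := card_opposite_traces_le hP hc hφ hS {2, 4} {0, 3} (by decide) (by decide)
      (by decide) (by decide)
    have k4 := card_opposite_traces_le hP hc hφ hS {0, 4} {2, 5} (by decide) (by decide)
      (by decide) (by decide)
    have hsub : F ⊆ (F.filter fun e => (trace φ e).card = 3) ∪
        (((F.filter fun e => trace φ e = {0, 2}) ∪ (F.filter fun e => trace φ e = {1, 4})) ∪
        ((F.filter fun e => trace φ e = {2, 4}) ∪ (F.filter fun e => trace φ e = {0, 3})) ∪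
        ((F.filter fun e => trace φ e = {0, 4}) ∪ (F.filter fun e => trace φ e = {2, 5}))) ∪
        (F.filter fun e => (trace φ e).card = 0) := by
      intro e he
      simp only [mem_union, mem_filter, he, true_and]
      rcases hcases e he with h | h | h
      · exact Or.inr h
      · have := trace_mem hP hφ he
        simp only [mem_insert, mem_singleton] at this
        tauto
      · exact Or.inl (Or.inl h)
    have q0 := card_le_card hsub
    have q1 := card_union_le (F.filter fun e => trace φ e = {0, 2})
      (F.filter fun e => trace φ e = {1, 4})
    have q2 := card_union_le (F.filter fun e => trace φ e = {2, 4})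
      (F.filter fun e => trace φ e = {0, 3})
    have q3 := card_union_le (F.filter fun e => trace φ e = {0, 4})
      (F.filter fun e => trace φ e = {2, 5})
    refine q0.trans ((card_union_le _ _).trans (Nat.add_le_add_right ?_ _))
    refine (card_union_le _ _).trans (Nat.add_le_add k3 ?_)
    refine (card_union_le _ _).trans ?_
    have q4 := card_union_le
      ((F.filter fun e => trace φ e = {0, 2}) ∪ (F.filter fun e => trace φ e = {1, 4}))
      ((F.filter fun e => trace φ e = {2, 4}) ∪ (F.filter fun e => trace φ e = {0, 3}))
    omega

end Trace

/-! ### Numerical comparisons -/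

/-- The maximum number of edges of a linear-path-free `3`-graph on `n` vertices. -/
def pathFreeBound (n : ℕ) : ℕ :=
  if n ≤ 6 then n.choose 3 else if n = 7 then 20 else (n - 1).choose 2

theorem pathFreeBound_of_le {n : ℕ} (hn : 8 ≤ n) : pathFreeBound n = (n - 1).choose 2 := by
  rw [pathFreeBound, if_neg (by omega), if_neg (by omega)]

/-- An attached vertex set around a triangle costs edges. -/
theorem component_bound_lt {m s : ℕ} (hs : 1 ≤ s) (h8 : 8 ≤ m + s) :
    14 + 3 * max s 2 + pathFreeBound m < 20 + (m + s - 1).choose 2 := by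
  by_cases hm : 8 ≤ m
  · obtain ⟨k, rfl⟩ : ∃ k, m = k + 1 := ⟨m - 1, by omega⟩
    rw [pathFreeBound_of_le hm, show k + 1 + s - 1 = k + s by omega, choose_two_add]
    have : 7 * s ≤ k * s := Nat.mul_le_mul_right s (by omega)
    simp only [Nat.add_sub_cancel]
    omega
  · obtain ⟨t, ht⟩ : ∃ t, m + s = 8 + t := ⟨m + s - 8, by omega⟩
    -- At `m + s = 8` the right side is 41, so the margin is one edge; each further unit of `t` adds
    -- at most 3 on the left and at least 7 on the right.
    have h1 : 14 + 3 * max (8 - m) 2 + pathFreeBound m ≤ 40 := by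
      have : m < 8 := by omega
      interval_cases m <;> decide
    rw [show m + s - 1 = 7 + t by omega, choose_two_add]
    have : Nat.choose 7 2 = 21 := by decide
    omega

theorem pathFreeBound_disjoint_lt {n : ℕ} (hn : 8 ≤ n) :
    20 + pathFreeBound (n - 6) < (n - 1).choose 2 := by
  by_cases h : n < 14
  · interval_cases n <;> decide
  · obtain ⟨k, rfl⟩ : ∃ k, n = k + 7 := ⟨n - 7, by omega⟩
    rw [pathFreeBound_of_le (by omega), show k + 7 - 1 = k + 6 by omega, choose_two_add,
      show k + 7 - 6 - 1 = k by omega]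
    omega

theorem pathFreeBound_component_lt {n m s : ℕ} (hn : 8 ≤ n) (hs : 1 ≤ s) (h : m + s = n - 6) :
    14 + 3 * max s 2 + pathFreeBound m < (n - 1).choose 2 := by
  by_cases h14 : n < 14
  · have : m < 8 := by omega
    have : s < 8 := by omega
    have hn : n = m + s + 6 := by omega
    subst hn
    interval_cases m <;> interval_cases s <;> first | omega | decide
  · have h1 := component_bound_lt hs (m := m) (by omega)
    obtain ⟨k, rfl⟩ : ∃ k, n = k + 7 := ⟨n - 7, by omega⟩
    rw [show k + 7 - 1 = k + 6 by omega, choose_two_add]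
    rw [show m + s - 1 = k by omega] at h1
    omega

/-! ### The Turán number of the path and its conditional version -/

section Bound

variable {V : Type*} [DecidableEq V]

theorem card_le_of_subset_or {F : Finset (Finset V)} {X U : Finset V}
    (h3 : F ⊆ X.powersetCard 3) (h : ∀ e ∈ F, e ⊆ U ∨ e ⊆ X \ U) :
    F = F.filter (· ⊆ U) ∪ F.filter (· ⊆ X \ U) ∧
    F.filter (· ⊆ U) ⊆ U.powersetCard 3 ∧ F.filter (· ⊆ X \ U) ⊆ (X \ U).powersetCard 3 := by
  refine ⟨?_, ?_, ?_⟩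
  · ext e
    simp only [mem_union, mem_filter]
    have := h e
    tauto
  · intro e he
    obtain ⟨he, hs⟩ := mem_filter.mp he
    exact mem_powersetCard.mpr ⟨hs, (mem_powersetCard.mp (h3 he)).2⟩
  · intro e he
    obtain ⟨he, hs⟩ := mem_filter.mp he
    exact mem_powersetCard.mpr ⟨hs, (mem_powersetCard.mp (h3 he)).2⟩

/-- The Turán number of the linear path of length three. -/
theorem card_le_of_pathFree (n : ℕ) : ∀ (F : Finset (Finset V)) (X : Finset V),
    PathFree F → F ⊆ X.powersetCard 3 → X.card = n → F.card ≤ pathFreeBound n ∧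
    (8 ≤ n → F.card = (n - 1).choose 2 → ∃ v ∈ X, F = (X.powersetCard 3).filter (v ∈ ·)) := by
  induction n using Nat.strong_induction_on with
  | _ n ih =>
  intro F X hP h3 hn
  by_cases hn6 : n ≤ 6
  · refine ⟨?_, fun h => by omega⟩
    rw [pathFreeBound, if_pos hn6, ← hn]
    exact card_le_choose_three h3
  by_cases hT : TriangleFree F
  · obtain ⟨-, h7, h8⟩ := card_le_of_pathFree_triangleFree n F X hP hT h3 hn
    by_cases hn7 : n = 7
    · refine ⟨?_, fun h => by omega⟩
      have := h7 hn7
      rw [hn7]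
      exact this.trans (by decide)
    · obtain ⟨h1, h2⟩ := h8 (by omega)
      rw [pathFreeBound_of_le (by omega)]
      exact ⟨h1, fun _ => h2⟩
  obtain ⟨φ, hφ⟩ := exists_embedding_of_not_triangleFree
    (fun e he => (mem_powersetCard.mp (h3 he)).2) hT
  -- A triangle makes the star bound strict from n = 8 on, so uniqueness comes from the
  -- triangle-free case. Size 7 is separate because 20 exceeds C(6, 2) = 15.
  suffices (n = 7 → F.card ≤ 20) ∧ (8 ≤ n → F.card < (n - 1).choose 2) by
    by_cases hn7 : n = 7
    · refine ⟨?_, fun h => by omega⟩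
      have := this.1 hn7
      rw [hn7]
      exact this.trans (by decide)
    · have := this.2 (by omega)
      rw [pathFreeBound_of_le (by omega)]
      exact ⟨this.le, fun _ h => absurd h this.ne⟩
  obtain ⟨U, hUX, hU6, h | ⟨S, hSX, hSne, G, hGF, hG, hcard⟩⟩ := exists_component hP h3 hφ
  · obtain ⟨hF, h1, h2⟩ := card_le_of_subset_or h3 h
    have hXU : (X \ U).card = n - 6 := by rw [card_sdiff_of_subset hUX, hn, hU6]
    have c1 := card_le_choose_three h1
    rw [hU6, show Nat.choose 6 3 = 20 by decide] at c1
    have c2 := (ih (n - 6) (by omega) _ _ (hP.mono (filter_subset (· ⊆ X \ U) _)) h2 hXU).1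
    have c3 := card_union_le (F.filter (· ⊆ U)) (F.filter (· ⊆ X \ U))
    rw [← hF] at c3
    constructor
    · rintro rfl
      have : pathFreeBound (7 - 6) = 0 := by decide
      omega
    · intro h8
      have := pathFreeBound_disjoint_lt h8
      omega
  · have hXU : (X \ U).card = n - 6 := by rw [card_sdiff_of_subset hUX, hn, hU6]
    have hXUS : ((X \ U) \ S).card = n - 6 - S.card := by rw [card_sdiff_of_subset hSX, hXU]
    have hS := card_le_card hSX
    have hS1 := card_pos.mpr hSne
    have c1 := (ih _ (by omega) G _ (hP.mono hGF) hG hXUS).1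
    constructor
    · rintro rfl
      have hS : S.card = 1 := by omega
      rw [hS] at c1 hcard
      have : pathFreeBound (7 - 6 - 1) = 0 := by decide
      omega
    · intro h8
      have := pathFreeBound_component_lt (n := n) (m := n - 6 - S.card) (s := S.card) h8 hS1
        (by omega)
      omega

/-- The largest families without linear path that contain a triangle. -/
theorem card_le_of_pathFree_of_triangle {n : ℕ} (hn : 14 ≤ n) {F : Finset (Finset V)}
    {X : Finset V} (hP : PathFree F) (h3 : F ⊆ X.powersetCard 3) (hX : X.card = n)
    {φ : Fin 6 ↪ V} (hφ : ∀ e ∈ triangle33.edges, e.map φ ∈ F) :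
    F.card ≤ 20 + (n - 7).choose 2 ∧ (F.card = 20 + (n - 7).choose 2 →
      ∃ U ⊆ X, U.card = 6 ∧ ∃ v ∈ X \ U,
        F = U.powersetCard 3 ∪ ((X \ U).powersetCard 3).filter (v ∈ ·)) := by
  obtain ⟨U, hUX, hU6, h | ⟨S, hSX, hSne, G, hGF, hG, hcard⟩⟩ := exists_component hP h3 hφ
  · obtain ⟨hF, h1, h2⟩ := card_le_of_subset_or h3 h
    have hXU : (X \ U).card = n - 6 := by rw [card_sdiff_of_subset hUX, hX, hU6]
    have hU20 : (U.powersetCard 3).card = 20 := by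
      rw [card_powersetCard, hU6]
      decide
    have c1 := card_le_card h1
    rw [hU20] at c1
    obtain ⟨c2, c4⟩ := card_le_of_pathFree (n - 6) _ _
      (hP.mono (filter_subset (· ⊆ X \ U) _)) h2 hXU
    rw [pathFreeBound_of_le (by omega)] at c2
    rw [show n - 6 - 1 = n - 7 by omega] at c2 c4
    have c3 := card_union_le (F.filter (· ⊆ U)) (F.filter (· ⊆ X \ U))
    rw [← hF] at c3
    refine ⟨by omega, fun heq => ⟨U, hUX, hU6, ?_⟩⟩
    -- Equality in the sum forces equality in both parts.
    obtain ⟨v, hv, hstar⟩ := c4 (by omega) (by omega)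
    refine ⟨v, hv, ?_⟩
    rw [← hstar, ← eq_of_subset_of_card_le h1 (by omega)]
    exact hF
  · have hXU : (X \ U).card = n - 6 := by rw [card_sdiff_of_subset hUX, hX, hU6]
    have hXUS : ((X \ U) \ S).card = n - 6 - S.card := by rw [card_sdiff_of_subset hSX, hXU]
    have hS := card_le_card hSX
    have c1 := (card_le_of_pathFree _ G _ (hP.mono hGF) hG hXUS).1
    have c2 := component_bound_lt (m := n - 6 - S.card) (card_pos.mpr hSne) (by omega)
    rw [show n - 6 - S.card + S.card - 1 = n - 7 by omega] at c2
    have : F.card < 20 + (n - 7).choose 2 := by omega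
    exact ⟨this.le, fun h => absurd h this.ne⟩

end Bound

/-! ### Invariance under isomorphism -/

section Isomorphism

variable {k : ℕ} {U V W : Type*}

theorem Isomorphic.symm {G : KGraph k V} {H : KGraph k W} (h : G.Isomorphic H) :
    H.Isomorphic G := by
  obtain ⟨f, hf⟩ := h
  refine ⟨f.symm, fun e => ?_⟩
  rw [hf, map_map]
  have : (f.symm.toEmbedding.trans f.toEmbedding) = Function.Embedding.refl W := by
    ext x
    simp
  rw [this, map_refl]

theorem ContainedIn.of_isomorphic {F : KGraph k U} {G : KGraph k V} {H : KGraph k W}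
    (h : F.ContainedIn G) (hGH : G.Isomorphic H) : F.ContainedIn H := by
  obtain ⟨f, hf⟩ := h
  obtain ⟨σ, hσ⟩ := hGH
  refine ⟨f.trans σ.toEmbedding, fun e he => ?_⟩
  rw [← map_map]
  exact (hσ _).mp (hf e he)

theorem Free.of_isomorphic {F : KGraph k U} {G : KGraph k V} {H : KGraph k W}
    (h : F.Free G) (hGH : G.Isomorphic H) : F.Free H :=
  fun hF => h (hF.of_isomorphic hGH.symm)

theorem Isomorphic.card_le {G : KGraph k V} {H : KGraph k W} (h : G.Isomorphic H) :
    G.edges.card ≤ H.edges.card := by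
  obtain ⟨f, hf⟩ := h
  exact card_le_card_of_injOn (fun e => e.map f.toEmbedding) (fun e he => (hf e).mp he)
    (map_injective _).injOn

theorem Isomorphic.card_eq {G : KGraph k V} {H : KGraph k W} (h : G.Isomorphic H) :
    G.edges.card = H.edges.card :=
  h.card_le.antisymm h.symm.card_le

/-- Transport of a `k`-graph along a bijection of the vertex sets. -/
def transport (G : KGraph k V) (σ : V ≃ W) : KGraph k W where
  edges := G.edges.map (mapEmbedding σ.toEmbedding).toEmbedding
  card_of_mem e he := by
    obtain ⟨a, ha, rfl⟩ := mem_map.mp he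
    exact (card_map _).trans (G.card_of_mem a ha)

theorem isomorphic_transport (G : KGraph k V) (σ : V ≃ W) : G.Isomorphic (G.transport σ) :=
  ⟨σ, fun e => by
    simp only [transport, mem_map]
    constructor
    · intro he
      exact ⟨e, he, rfl⟩
    · rintro ⟨a, ha, h⟩
      exact map_injective _ h ▸ ha⟩

end Isomorphism

/-! ### The extremal 3-graph -/

section Extremal

variable {m : ℕ}

theorem mem_complete_disjointUnion_fullStar (hm : 0 < m) {e : Finset (Fin 6 ⊕ Fin m)} :
    e ∈ ((complete 3 6).disjointUnion (fullStar 3 m)).edges ↔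
      e.card = 3 ∧ ((∀ x ∈ e, x.isLeft) ∨ ((∀ x ∈ e, x.isRight) ∧ Sum.inr ⟨0, hm⟩ ∈ e)) := by
  constructor
  · intro he
    refine ⟨card_of_mem _ e he, ?_⟩
    simp only [disjointUnion, mem_union, mem_image] at he
    rcases he with ⟨a, ha, rfl⟩ | ⟨a, ha, rfl⟩
    · left
      intro x hx
      obtain ⟨i, -, rfl⟩ := mem_map.mp hx
      rfl
    · right
      constructor
      · intro x hx
        obtain ⟨i, -, rfl⟩ := mem_map.mp hx
        rfl
      · obtain ⟨v, hv, hv0⟩ := (mem_filter.mp ha).2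
        have : v = ⟨0, hm⟩ := Fin.ext hv0
        subst this
        exact mem_map_of_mem Function.Embedding.inr hv
  · rintro ⟨hc, h | ⟨h, h0⟩⟩
    · have heq : e = (univ.filter (fun i => Sum.inl i ∈ e)).map Function.Embedding.inl := by
        ext x
        rcases x with x | x
        · simp
        · simp only [mem_map, Function.Embedding.inl_apply, reduceCtorEq, and_false, exists_false,
            iff_false]
          exact fun hx => by simpa using h _ hx
      rw [heq, card_map] at hc
      simp only [disjointUnion, mem_union, mem_image]
      exact Or.inl ⟨_, mem_powersetCard_univ.mpr hc, heq.symm⟩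
    · have heq : e = (univ.filter (fun i => Sum.inr i ∈ e)).map Function.Embedding.inr := by
        ext x
        rcases x with x | x
        · simp only [mem_map, Function.Embedding.inr_apply, reduceCtorEq, and_false, exists_false,
            iff_false]
          exact fun hx => by simpa using h _ hx
        · simp
      rw [heq, card_map] at hc
      simp only [disjointUnion, mem_union, mem_image]
      exact Or.inr ⟨_, mem_filter.mpr ⟨mem_powersetCard_univ.mpr hc, ⟨0, hm⟩, by simpa using h0, rfl⟩,
        heq.symm⟩

theorem card_complete_disjointUnion_fullStar (hm : 0 < m) :
    ((complete 3 6).disjointUnion (fullStar 3 m)).edges.card = 20 + (m - 1).choose 2 := by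
  have hd : Disjoint ((complete 3 6).edges.image fun e => e.map Function.Embedding.inl)
      ((fullStar 3 m).edges.image fun e => e.map (Function.Embedding.inr : Fin m ↪ Fin 6 ⊕ Fin m)) := by
    rw [disjoint_left]
    intro e he he'
    obtain ⟨a, ha, rfl⟩ := mem_image.mp he
    obtain ⟨b, hb, hab⟩ := mem_image.mp he'
    have h3 := (complete 3 6).card_of_mem a ha
    obtain ⟨x, hx⟩ := card_pos.mp (show 0 < a.card by omega)
    have := mem_map_of_mem (Function.Embedding.inl : Fin 6 ↪ Fin 6 ⊕ Fin m) hx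
    rw [← hab] at this
    simp at this
  have h1 : (complete 3 6).edges.card = 20 := by
    simp only [complete, card_powersetCard, card_univ, Fintype.card_fin]
    decide
  have h2 : (fullStar 3 m).edges.card = (m - 1).choose 2 := by
    have := card_star (X := univ) (v := (⟨0, hm⟩ : Fin m)) (mem_univ _)
    rw [card_univ, Fintype.card_fin] at this
    rw [← this, fullStar]
    congr 1
    ext e
    simp only [mem_filter, and_congr_right_iff]
    intro _
    constructor
    · rintro ⟨v, hv, hv0⟩
      have : v = ⟨0, hm⟩ := Fin.ext hv0
      exact this ▸ hv
    · exact fun h => ⟨_, h, rfl⟩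
  rw [disjointUnion, card_union_of_disjoint hd, card_image_of_injective _ (map_injective _),
    card_image_of_injective _ (map_injective _), h1, h2]

/-- Consecutive edges of a path lie in one component. In the complete part, disjoint end edges cover
all six vertices, leaving the middle edge only 1 + 1 vertices; in the star, the end edges share the
centre. -/
theorem pathFree_complete_disjointUnion_fullStar (hm : 0 < m) :
    PathFree ((complete 3 6).disjointUnion (fullStar 3 m)).edges := by
  intro e he f hf g hg hef hfg heg
  rw [mem_complete_disjointUnion_fullStar hm] at he hf hg
  obtain ⟨x, hx⟩ := card_pos.mp (show 0 < (e ∩ f).card by omega)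
  obtain ⟨y, hy⟩ := card_pos.mp (show 0 < (f ∩ g).card by omega)
  obtain ⟨hxe, hxf⟩ := mem_inter.mp hx
  obtain ⟨hyf, hyg⟩ := mem_inter.mp hy
  have heg' := card_eq_zero.mp heg
  rcases hf.2 with hl | ⟨hr, -⟩
  · have hel : ∀ z ∈ e, z.isLeft := by
      rcases he.2 with h | ⟨h, -⟩
      · exact h
      · have h1 := h x hxe
        have h2 := hl x hxf
        rw [← Sum.not_isLeft] at h1
        simp [h2] at h1
    have hgl : ∀ z ∈ g, z.isLeft := by
      rcases hg.2 with h | ⟨h, -⟩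
      · exact h
      · have h1 := h y hyg
        have h2 := hl y hyf
        rw [← Sum.not_isLeft] at h1
        simp [h2] at h1
    have hsub : ∀ a : Finset (Fin 6 ⊕ Fin m), (∀ z ∈ a, z.isLeft) →
        a ⊆ univ.map Function.Embedding.inl := by
      intro a ha z hz
      obtain ⟨i, rfl⟩ := Sum.isLeft_iff.mp (ha z hz)
      simp
    have hu : (e ∪ g).card = 6 := by
      rw [card_union_of_disjoint (disjoint_iff_inter_eq_empty.mpr heg'), he.1, hg.1]
    have heq := eq_of_subset_of_card_le (union_subset (hsub e hel) (hsub g hgl))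
      (by rw [hu]; simp)
    have hfu : f ⊆ (e ∩ f) ∪ (f ∩ g) := by
      intro z hz
      have := hsub f hl hz
      rw [← heq] at this
      simp only [mem_union, mem_inter] at this ⊢
      tauto
    have h1 := card_le_card hfu
    have h2 := card_union_le (e ∩ f) (f ∩ g)
    omega
  · have h0e : Sum.inr ⟨0, hm⟩ ∈ e := by
      rcases he.2 with h | ⟨-, h⟩
      · have h1 := h x hxe
        have h2 := hr x hxf
        rw [← Sum.not_isLeft] at h2
        simp [h1] at h2
      · exact h
    have h0g : Sum.inr ⟨0, hm⟩ ∈ g := by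
      rcases hg.2 with h | ⟨-, h⟩
      · have h1 := h y hyg
        have h2 := hr y hyf
        rw [← Sum.not_isLeft] at h2
        simp [h1] at h2
      · exact h
    have := mem_inter.mpr ⟨h0e, h0g⟩
    rw [heg'] at this
    simp at this

theorem triangle_containedIn_complete_disjointUnion_fullStar (hm : 0 < m) :
    triangle33.ContainedIn ((complete 3 6).disjointUnion (fullStar 3 m)) := by
  refine ⟨Function.Embedding.inl, fun e he => ?_⟩
  rw [mem_complete_disjointUnion_fullStar hm, card_map]
  refine ⟨triangle33.card_of_mem e he, Or.inl fun x hx => ?_⟩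
  obtain ⟨i, -, rfl⟩ := mem_map.mp hx
  rfl

theorem isomorphic_complete_disjointUnion_fullStar {V : Type*} [Fintype V] [DecidableEq V]
    {H : KGraph 3 V} {U : Finset V} {v : V} (hU : U.card = 6)
    (hV : Fintype.card V = m + 6) (hm : 0 < m) (hv : v ∉ U)
    (hH : H.edges = U.powersetCard 3 ∪ ((univ \ U).powersetCard 3).filter (v ∈ ·)) :
    H.Isomorphic ((complete 3 6).disjointUnion (fullStar 3 m)) := by
  have e1 : {x // x ∈ U} ≃ Fin 6 := Fintype.equivFinOfCardEq (by simpa using hU)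
  have e2 : {x // ¬ x ∈ U} ≃ Fin m := Fintype.equivFinOfCardEq (by
    rw [Fintype.card_subtype_compl, hV, Fintype.card_coe, hU]
    rfl)
  -- The swap sends `v` to the centre of the star.
  let e2' := e2.trans (Equiv.swap (e2 ⟨v, hv⟩) ⟨0, hm⟩)
  let σ : V ≃ Fin 6 ⊕ Fin m := (Equiv.sumCompl (· ∈ U)).symm.trans (Equiv.sumCongr e1 e2')
  have hσU : ∀ x (h : x ∈ U), σ x = Sum.inl (e1 ⟨x, h⟩) := fun x h => by
    simp [σ, Equiv.sumCompl_symm_apply_of_pos h]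
  have hσN : ∀ x (h : x ∉ U), σ x = Sum.inr (e2' ⟨x, h⟩) := fun x h => by
    simp [σ, Equiv.sumCompl_symm_apply_of_neg h]
  have hσv : σ v = Sum.inr ⟨0, hm⟩ := by
    rw [hσN v hv]
    simp [e2']
  have hleft : ∀ x, (σ x).isLeft ↔ x ∈ U := fun x => by
    by_cases h : x ∈ U
    · simp [hσU x h, h]
    · simp [hσN x h, h]
  have hright : ∀ x, (σ x).isRight ↔ x ∉ U := fun x => by
    by_cases h : x ∈ U
    · simp [hσU x h, h]
    · simp [hσN x h, h]
  refine ⟨σ, fun e => ?_⟩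
  rw [mem_complete_disjointUnion_fullStar hm, card_map, ← hσv, hH]
  simp only [mem_union, mem_filter, mem_powersetCard, mem_map, Equiv.toEmbedding_apply,
    forall_exists_index, and_imp, forall_apply_eq_imp_iff₂, hleft, hright,
    EmbeddingLike.apply_eq_iff_eq, exists_eq_right, subset_iff, mem_sdiff, mem_univ, true_and]
  tauto

end Extremal

end KGraph

/-! ### The conditional Turán number and the extremal graphs -/

theorem mainTheorem3 (n : ℕ) (hn : 14 ≤ n) :
    IsGreatest (KGraph.condEdgeCounts n KGraph.linearPath33 KGraph.triangle33)
        (20 + (n - 7).choose 2) ∧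
    KGraph.condTuran n KGraph.linearPath33 KGraph.triangle33 = 20 + (n - 7).choose 2 ∧
    ∀ (V : Type*) [Fintype V] (H : KGraph 3 V), Fintype.card V = n →
      (KGraph.IsCondExtremal KGraph.linearPath33 KGraph.triangle33 H ↔
        H.Isomorphic ((KGraph.complete 3 6).disjointUnion (KGraph.fullStar 3 (n - 6)))) := by
  classical
  have hm : 0 < n - 6 := by omega
  have hfree := KGraph.free_of_pathFree (KGraph.pathFree_complete_disjointUnion_fullStar hm)
  have htri := KGraph.triangle_containedIn_complete_disjointUnion_fullStar hm
  have hcard := KGraph.card_complete_disjointUnion_fullStar hm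
  rw [show n - 6 - 1 = n - 7 by omega] at hcard
  have hgreatest : IsGreatest (KGraph.condEdgeCounts n KGraph.linearPath33 KGraph.triangle33)
      (20 + (n - 7).choose 2) := by
    constructor
    · have σ : Fin 6 ⊕ Fin (n - 6) ≃ Fin n := finSumFinEquiv.trans (finCongr (by omega))
      have hiso := KGraph.isomorphic_transport
        ((KGraph.complete 3 6).disjointUnion (KGraph.fullStar 3 (n - 6))) σ
      exact ⟨_, hfree.of_isomorphic hiso, htri.of_isomorphic hiso, hiso.card_eq.symm.trans hcard⟩
    · rintro k ⟨H, hP, ⟨φ, hφ⟩, rfl⟩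
      exact (KGraph.card_le_of_pathFree_of_triangle hn (KGraph.pathFree_of_free hP)
        (fun e he => Finset.mem_powersetCard_univ.mpr (H.card_of_mem e he)) (by simp) hφ).1
  have hturan : KGraph.condTuran n KGraph.linearPath33 KGraph.triangle33 =
      20 + (n - 7).choose 2 := hgreatest.csSup_eq
  refine ⟨hgreatest, hturan, ?_⟩
  intro V _ H hV
  rw [KGraph.IsCondExtremal, hV, hturan]
  constructor
  · rintro ⟨hP, ⟨φ, hφ⟩, hc⟩
    obtain ⟨U, -, hU, v, hv, hH⟩ := (KGraph.card_le_of_pathFree_of_triangle hn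
      (KGraph.pathFree_of_free hP)
      (fun e he => Finset.mem_powersetCard_univ.mpr (H.card_of_mem e he))
      (by rw [Finset.card_univ, hV]) hφ).2 hc
    exact KGraph.isomorphic_complete_disjointUnion_fullStar hU (by omega) hm
      (Finset.mem_sdiff.mp hv).2 hH
  · intro hiso
    exact ⟨hfree.of_isomorphic hiso.symm, htri.of_isomorphic hiso.symm,
      hiso.card_eq.trans hcard⟩
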